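/- **Setting.** Let $G$ be a triorthogonal binary matrix with $n$ columns: any two distinct rows and any three distinct rows have even overlap, i.e. $\sum_j G_{a,j}G_{b,j}=0 \pmod 2$ for $a<b$ and $\sum_j G_{a,j}G_{b,j}G_{c,j}=0\pmod 2$ for $a<b<c$. Suppose that its first $k\ge 0$ rows $f^1,\dots,f^k$ have odd weight and the remaining $r\ge 0$ rows have even weight. Let $\mathcal G_0$ be the span over $\mathbb F_2$ of the even-weight rows and $\mathcal G$ the span of all rows; $\mathcal W^\perp$ denotes the dual of $\mathcal W\subseteq\mathbb F_2^n$ under the binary inner product, $|f|$ the Hamming weight, and $(f^a)=\{0,f^a\}$. For a one-qubit operator $O$ put $O(f)=O^{f_1}\otimes\cdots\otimes O^{f_n}$. Put $T=\mathrm{diag}(1,e^{i\pi/4})$, $S=\mathrm{diag}(1,i)$, $|A\rangle=|A_0\rangle=T|+\rangle$, $|A_1\rangle=Z|A\rangle$, $|A_x\rangle=|A_{x_1}\rangle\otimes\cdots\otimes|A_{x_k}\rangle$, $|G\rangle=\sum_{g\in\mathcal G}|g\rangle$, $|G_0\rangle=\sum_{g\in\mathcal G_0}|g\rangle$, $|\overline{A^{\otimes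 k}}\rangle=\prod_{a=1}^k(I+e^{i\pi/4}X(f^a))|G_0\rangle$. Consider the stabilizer code with stabilizers $X(f)$, $f\in\mathcal G_0$, and $Z(g)$, $g\in\mathcal G^\perp$; let $\Pi_0$ be the projector onto its code space and let $V$ be the encoder $$V|x\rangle=|\mathcal G_0|^{-1/2}\sum_{f\in\mathcal G_0+x_1f^1+\dots+x_kf^k}|f\rangle,\qquad x\in\mathbb F_2^k .$$ **Subroutine.** Let $0\le p\le 1$ and $\rho=(1-p)|A_0\rangle\langle A_0|+p|A_1\rangle\langle A_1|$. Prepare the normalized state $|G\rangle\langle G|/|\mathcal G|$. Apply to each of the $n$ qubits the $T$-gate injection circuit, which consumes one copy of $\rho$: CNOT controlled by the ancilla and targeting the data qubit, $Z$-basis measurement of the data qubit, $SX$ on the ancilla if the outcome is $1$; the ancilla becomes the new data qubit. Apply a unitary $U$ composed of controlled-$Z$ and $S$ gates only such that $U\,T^{\otimes n}|G\rangle=|\overline{A^{\otimes k}}\rangle$; call the result $\eta_2$. Measure $X(f)$ for every row $f$ of even weight and keep the state only if all outcomes are $+1$; let $P_s$ be the probability of this and $\eta_3$ the normalized post-selected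 state. Output the decoded state $\rho_{out}=V^\dagger\eta_3V$. Let $q_a$ be the error rate of output qubit $a$, i.e. $1-q_a=\langle A|\rho_{out,a}|A\rangle$ for its marginal $\rho_{out,a}$. **Claim.** A unitary $U$ as above exists, and $V^\dagger V=I$, $VV^\dagger=\Pi_0$. For every $0\le p\le 1$, the $n$ injection circuits with ancillas $\rho^{\otimes n}$ act on every $n$-qubit operator $\eta$ as the noisy transversal $T$-gate $$\eta\mapsto\sum_{f\in\mathbb F_2^n}(1-p)^{n-|f|}p^{|f|}\,Z(f)\,T^{\otimes n}\eta\,(T^{\otimes n})^\dagger Z(f).$$ For every such $U$ and every $0\le p\le1$: 1. $\displaystyle P_s=\sum_{f\in\mathcal G_0^\perp}(1-p)^{n-|f|}p^{|f|}=\frac1{|\mathcal G_0|}\sum_{f\in\mathcal G_0}(1-2p)^{|f|}>0.$ 2. The measurements with all outcomes $+1$ project $\eta_2$ onto the code space, the unnormalized post-selected state being $\Pi_0\eta_2\Pi_0$, and $\eta_3=V\rho_{out}V^\dagger$, where $$\rho_{out}=\frac1{P_s}\sum_{x\in\mathbb F_2^k}p_{out}(x)\,|A_x\rangle\langle A_x|,\qquad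 p_{out}(x)=\sum_{f\in\mathcal G^\perp+x_1f^1+\dots+x_kf^k}(1-p)^{n-|f|}p^{|f|}.$$ 3. For every $a=1,\dots,k$, $\rho_{out,a}=(1-q_a)|A_0\rangle\langle A_0|+q_a|A_1\rangle\langle A_1|$ and $$q_a=1-\frac1{P_s}\sum_{x:\,x_a=0}p_{out}(x)=1-\frac{\sum_{f\in(\mathcal G_0\oplus(f^a))^\perp}(1-p)^{n-|f|}p^{|f|}}{\sum_{f\in\mathcal G_0^\perp}(1-p)^{n-|f|}p^{|f|}}=1-\frac12\,\frac{\sum_{f\in\mathcal G_0\oplus(f^a)}(1-2p)^{|f|}}{\sum_{f\in\mathcal G_0}(1-2p)^{|f|}}.$$ 4. If $k\ge1$, then $\mathcal G_0^\perp\setminus\mathcal G^\perp$ is non-empty, and the worst-case output error rate $q=\max_a q_a$ satisfies $q=O(p^d)$ as $p\to0^+$ (for fixed $G$), where $d=\min_{f\in\mathcal G_0^\perp\setminus\mathcal G^\perp}|f|$. -/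

import Mathlib

open Matrix Filter Topology Asymptotics
open scoped Kronecker

noncomputable section

namespace MagicDistill

/-! ### Binary linear algebra -/

/-- Binary vectors of length `n`; they also label the computational basis of `n` qubits. -/
abbrev Bits (n : ℕ) : Type := Fin n → ZMod 2

/-- Operators on `n` qubits, as matrices in the computational basis. -/
abbrev Op (n : ℕ) : Type := Matrix (Bits n) (Bits n) ℂ

/-- Triorthogonality: any pair and any triple of rows has even overlap. -/
structure IsTriorthogonal {m n : ℕ} (G : Matrix (Fin m) (Fin n) (ZMod 2)) : Prop where
  pair : ∀ a b : Fin m, a < b → ∑ j, G a j * G b j = 0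
  triple : ∀ a b c : Fin m, a < b → b < c → ∑ j, G a j * G b j * G c j = 0

/-- The `a`-th row `f^a` of the submatrix `G₁` formed by the first `k` rows. -/
def oddRow {k r n : ℕ} (G : Matrix (Fin (k + r)) (Fin n) (ZMod 2)) (a : Fin k) : Bits n :=
  G (Fin.castAdd r a)

/-- The `b`-th row of the submatrix `G₀` formed by the last `r` rows. -/
def evenRow {k r n : ℕ} (G : Matrix (Fin (k + r)) (Fin n) (ZMod 2)) (b : Fin r) : Bits n :=
  G (Fin.natAdd k b)

/-- The space `𝒢₀` spanned by the rows of `G₀`. -/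
def evenSpace {k r n : ℕ} (G : Matrix (Fin (k + r)) (Fin n) (ZMod 2)) :
    Submodule (ZMod 2) (Bits n) :=
  Submodule.span (ZMod 2) (Set.range (evenRow G))

/-- The space `𝒢` spanned by all rows of `G`. -/
def rowSpace {m n : ℕ} (G : Matrix (Fin m) (Fin n) (ZMod 2)) :
    Submodule (ZMod 2) (Bits n) :=
  Submodule.span (ZMod 2) (Set.range fun i : Fin m => (G i : Bits n))

/-- The dual space `W^⊥` with respect to the binary inner product. -/
def dual {n : ℕ} (W : Submodule (ZMod 2) (Bits n)) : Submodule (ZMod 2) (Bits n) where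
  carrier := {f | ∀ g ∈ W, f ⬝ᵥ g = 0}
  zero_mem' := fun g _ => zero_dotProduct g
  add_mem' := fun {a b} ha hb g hg => by rw [add_dotProduct, ha g hg, hb g hg, add_zero]
  smul_mem' := fun c a ha g hg => by rw [smul_dotProduct, ha g hg, smul_zero]

/-- The finite set of elements of a binary linear space. -/
def elems {n : ℕ} (W : Submodule (ZMod 2) (Bits n)) : Finset (Bits n) :=
  (Set.toFinite (W : Set (Bits n))).toFinset

/-- The linear combination `x₁ f¹ + ⋯ + x_k f^k` of the rows of `G₁`. -/
def oddComb {k r n : ℕ} (G : Matrix (Fin (k + r)) (Fin n) (ZMod 2)) (x : Bits k) : Bits n :=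
  ∑ a, x a • oddRow G a

/-- Probability `(1-p)^{n-|f|} p^{|f|}` of the error pattern `f`, where `|f|` is the weight. -/
def errProb {n : ℕ} (p : ℝ) (f : Bits n) : ℝ :=
  (1 - p) ^ (n - hammingNorm f) * p ^ hammingNorm f

/-- The weight enumerator `∑_{f ∈ W} t^{|f|}`. -/
def weightEnum {n : ℕ} (W : Submodule (ZMod 2) (Bits n)) (t : ℝ) : ℝ :=
  ∑ f ∈ elems W, t ^ hammingNorm f

/-- The distance `d = min {|f| : f ∈ 𝒢₀^⊥ \ 𝒢^⊥}` against `Z`-type errors. -/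
def zDistance {k r n : ℕ} (G : Matrix (Fin (k + r)) (Fin n) (ZMod 2)) : ℕ :=
  sInf {w | ∃ f ∈ dual (evenSpace G), f ∉ dual (rowSpace G) ∧ hammingNorm f = w}

/-- `p_out(x)`, the total probability of the errors in the coset
`𝒢^⊥ + x₁ f¹ + ⋯ + x_k f^k`. -/
def pOut {k r n : ℕ} (G : Matrix (Fin (k + r)) (Fin n) (ZMod 2)) (p : ℝ) (x : Bits k) : ℝ :=
  ∑ g ∈ elems (dual (rowSpace G)), errProb p (g + oddComb G x)

/-! ### Qubits, gates and states -/

/-- The phase `e^{iπ/4}`. -/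
def omega8 : ℂ := Complex.exp (Complex.I * Real.pi / 4)

/-- Pauli `X`. -/
def gateX : Matrix (ZMod 2) (ZMod 2) ℂ := Matrix.of fun s t => if s = t + 1 then 1 else 0

/-- Pauli `Z`. -/
def gateZ : Matrix (ZMod 2) (ZMod 2) ℂ := Matrix.diagonal fun s => if s = 0 then 1 else -1

/-- The `S`-gate `diag(1, i)`. -/
def gateS : Matrix (ZMod 2) (ZMod 2) ℂ :=
  Matrix.diagonal fun s => if s = 0 then 1 else Complex.I

/-- The `T`-gate `diag(1, e^{iπ/4})`, which is `exp(-iπZ/8)` up to a global phase. -/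
def gateT : Matrix (ZMod 2) (ZMod 2) ℂ :=
  Matrix.diagonal fun s => if s = 0 then 1 else omega8

/-- The tensor product of single-qubit operators. -/
def tensor {n : ℕ} (M : Fin n → Matrix (ZMod 2) (ZMod 2) ℂ) : Op n :=
  Matrix.of fun x y => ∏ j, M j (x j) (y j)

/-- The tensor product of single-qubit vectors. -/
def tensorVec {n : ℕ} (v : Fin n → ZMod 2 → ℂ) : Bits n → ℂ := fun x => ∏ j, v j (x j)

/-- `O(f) = O^{f₁} ⊗ ⋯ ⊗ O^{f_n}`. -/
def opString {n : ℕ} (O : Matrix (ZMod 2) (ZMod 2) ℂ) (f : Bits n) : Op n :=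
  tensor fun j => O ^ (f j).val

/-- The transversal gate `T^{⊗n}`. -/
def transT (n : ℕ) : Op n := tensor fun _ => gateT

/-- The `S`-gate applied to qubit `j`. -/
def gateSAt {n : ℕ} (j : Fin n) : Op n := tensor (Function.update (fun _ => 1) j gateS)

/-- The controlled-`Z` gate applied to qubits `i` and `j`. -/
def gateCZ {n : ℕ} (i j : Fin n) : Op n :=
  Matrix.diagonal fun x => if x i = 1 ∧ x j = 1 then -1 else 1

/-- The operators composed of controlled-`Z` and `S` gates only. Since `S ^ 4 = 1` and
`CZ ^ 2 = 1`, this monoid contains the inverses of its elements. -/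
def diagClifford (n : ℕ) : Submonoid (Op n) :=
  Submonoid.closure
    ({M | ∃ j : Fin n, M = gateSAt j} ∪ {M | ∃ i j : Fin n, i ≠ j ∧ M = gateCZ i j})

/-- The state `|+⟩`. -/
def ketPlus : ZMod 2 → ℂ := fun _ => ((Real.sqrt 2 : ℝ) : ℂ)⁻¹

/-- The states `|A₀⟩ = |A⟩ = T|+⟩` and `|A₁⟩ = Z|A⟩`. -/
def ketA (α : ZMod 2) : ZMod 2 → ℂ := (gateZ ^ α.val) *ᵥ (gateT *ᵥ ketPlus)

/-- `|A_x⟩ = |A_{x₁}⟩ ⊗ ⋯ ⊗ |A_{x_k}⟩`. -/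
def ketAs {k : ℕ} (x : Bits k) : Bits k → ℂ := tensorVec fun a => ketA (x a)

/-- `|v⟩⟨v|`. -/
def ketbra {ι : Type*} (v : ι → ℂ) : Matrix ι ι ℂ := Matrix.vecMulVec v (star v)

/-- The raw ancilla `ρ = (1-p)|A₀⟩⟨A₀| + p|A₁⟩⟨A₁|`. -/
def rawAncilla (p : ℝ) : Matrix (ZMod 2) (ZMod 2) ℂ :=
  ((1 - p : ℝ) : ℂ) • ketbra (ketA 0) + ((p : ℝ) : ℂ) • ketbra (ketA 1)

/-- `n` copies `ρ^{⊗n}` of the raw ancilla. -/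
def rawAncillas (n : ℕ) (p : ℝ) : Op n := tensor fun _ => rawAncilla p

/-- The reduced density matrix of qubit `a`. -/
def marginal {k : ℕ} (ρ : Op k) (a : Fin k) : Matrix (ZMod 2) (ZMod 2) ℂ :=
  Matrix.of fun s t => ∑ x : Bits k with x a = 0,
    ρ (Function.update x a s) (Function.update x a t)

/-! ### The noisy transversal `T`-gate -/

/-- `(𝓔 ∘ 𝓣)^{⊗n}`: the ideal transversal `T`-gate, followed by a `Z`-error on each qubit
independently with probability `p`. -/
def noisyT {n : ℕ} (p : ℝ) (η : Op n) : Op n :=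
  ∑ f : Bits n, ((errProb p f : ℝ) : ℂ) •
    (opString gateZ f * (transT n * η * (transT n)ᴴ) * opString gateZ f)

/-- Transversal CNOT on a data register (first factor) and an ancilla register (second factor);
ancilla qubit `j` controls data qubit `j`. -/
def transCNOT (n : ℕ) : Matrix (Bits n × Bits n) (Bits n × Bits n) ℂ :=
  Matrix.of fun u v => if u.2 = v.2 ∧ u.1 = v.1 + v.2 then 1 else 0

/-- The operator `⟨s| ⊗ I` reading out the data register. -/
def readOut {n : ℕ} (s : Bits n) : Matrix (Bits n) (Bits n × Bits n) ℂ :=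
  Matrix.of fun y v => if v.1 = s ∧ y = v.2 then 1 else 0

/-- The branch with outcome `s` of the `T`-gate injection circuit on `n` qubits: transversal CNOT,
measurement of the data register with outcome `s`, and the gate `SX` on those ancilla qubits whose
partner gave the outcome `1`. The ancilla register becomes the new data register. -/
def injectKraus {n : ℕ} (s : Bits n) : Matrix (Bits n) (Bits n × Bits n) ℂ :=
  opString (gateS * gateX) s * readOut s * transCNOT n

/-- The `T`-gate injection circuit, applied to data `η` and ancillas `σ`. -/
def injectT {n : ℕ} (η σ : Op n) : Op n :=
  ∑ s : Bits n, injectKraus s * (η ⊗ₖ σ) * (injectKraus s)ᴴ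

/-! ### The code with `X`-stabilizers `X(𝒢₀)` and `Z`-stabilizers `Z(𝒢^⊥)` -/

/-- The unnormalized state `∑_{g ∈ W} |g⟩`. -/
def ketSpace {n : ℕ} (W : Submodule (ZMod 2) (Bits n)) : Bits n → ℂ :=
  Set.indicator (W : Set (Bits n)) 1

/-- The unnormalized encoded state `∏_a (I + e^{iπ/4} X(f^a)) |G₀⟩`. -/
def ketEncodedA {k r n : ℕ} (G : Matrix (Fin (k + r)) (Fin n) (ZMod 2)) : Bits n → ℂ :=
  (List.ofFn fun a : Fin k => 1 + omega8 • opString gateX (oddRow G a)).prod *ᵥ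
    ketSpace (evenSpace G)

/-- `U` is composed of controlled-`Z` and `S` gates and maps `T^{⊗n}|G⟩` to the encoded
`|A^{⊗k}⟩`. -/
def IsCorrecting {k r n : ℕ} (G : Matrix (Fin (k + r)) (Fin n) (ZMod 2)) (U : Op n) : Prop :=
  U ∈ diagClifford n ∧ U *ᵥ (transT n *ᵥ ketSpace (rowSpace G)) = ketEncodedA G

/-- The encoder: its column `x` is the normalized encoded basis state
`∑ |f⟩`, `f ∈ 𝒢₀ + x₁ f¹ + ⋯ + x_k f^k`. -/
def encoder {k r n : ℕ} (G : Matrix (Fin (k + r)) (Fin n) (ZMod 2)) :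
    Matrix (Bits n) (Bits k) ℂ :=
  Matrix.of fun y x =>
    ((Real.sqrt (Nat.card (evenSpace G)) : ℝ) : ℂ)⁻¹ *
      ketSpace (evenSpace G) (y - oddComb G x)

/-- The projector onto the code space: the average of the stabilizer group. -/
def codeProj {k r n : ℕ} (G : Matrix (Fin (k + r)) (Fin n) (ZMod 2)) : Op n :=
  ((Nat.card (evenSpace G) : ℂ)⁻¹ • ∑ f ∈ elems (evenSpace G), opString gateX f) *
    ((Nat.card (dual (rowSpace G)) : ℂ)⁻¹ •
      ∑ g ∈ elems (dual (rowSpace G)), opString gateZ g)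

/-- The operator of obtaining the outcome `+1` in the successive measurements of `X(f)` for all
rows `f` of `G₀`. -/
def trivialSyndrome {k r n : ℕ} (G : Matrix (Fin (k + r)) (Fin n) (ZMod 2)) : Op n :=
  (List.ofFn fun b : Fin r => (1 / 2 : ℂ) • (1 + opString gateX (evenRow G b))).prod

/-! ### The distillation subroutine -/

/-- The normalized state `|G⟩⟨G|`, that is, the encoded `|+^{⊗k}⟩`. -/
def initState {k r n : ℕ} (G : Matrix (Fin (k + r)) (Fin n) (ZMod 2)) : Op n :=
  (Nat.card (rowSpace G) : ℂ)⁻¹ • ketbra (ketSpace (rowSpace G))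

/-- The state before the syndrome measurement, when the `n` ancillas are in the state `σ`. -/
def etaTwo {k r n : ℕ} (G : Matrix (Fin (k + r)) (Fin n) (ZMod 2)) (U σ : Op n) : Op n :=
  U * injectT (initState G) σ * Uᴴ

/-- The unnormalized state after all measurements returned `+1`. -/
def postSelected {k r n : ℕ} (G : Matrix (Fin (k + r)) (Fin n) (ZMod 2)) (U σ : Op n) : Op n :=
  trivialSyndrome G * etaTwo G U σ * (trivialSyndrome G)ᴴ

/-- The success probability `P_s`. -/
def successProb {k r n : ℕ} (G : Matrix (Fin (k + r)) (Fin n) (ZMod 2)) (U σ : Op n) : ℝ :=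
  (Matrix.trace (postSelected G U σ)).re

/-- The normalized post-selected state. -/
def etaThree {k r n : ℕ} (G : Matrix (Fin (k + r)) (Fin n) (ZMod 2)) (U σ : Op n) : Op n :=
  ((successProb G U σ : ℝ) : ℂ)⁻¹ • postSelected G U σ

/-- The `k`-qubit output of the subroutine, obtained by decoding the post-selected state. -/
def outputState {k r n : ℕ} (G : Matrix (Fin (k + r)) (Fin n) (ZMod 2)) (U σ : Op n) : Op k :=
  (encoder G)ᴴ * etaThree G U σ * encoder G

/-- The output error rate of qubit `a`: one minus the overlap `⟨A|ρ_a|A⟩` of its marginal. -/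
def outputError {k r n : ℕ} (G : Matrix (Fin (k + r)) (Fin n) (ZMod 2)) (U σ : Op n)
    (a : Fin k) : ℝ :=
  1 - (star (ketA 0) ⬝ᵥ (marginal (outputState G U σ) a *ᵥ ketA 0)).re

/-- The worst-case output error rate `q = max_a q_a`. -/
def worstError {k r n : ℕ} (G : Matrix (Fin (k + r)) (Fin n) (ZMod 2)) (U σ : Op n) : ℝ :=
  ⨆ a : Fin k, outputError G U σ a

end MagicDistill

end

open MagicDistill

/-! Two facts about triorthogonal matrices carry the proof. The linear one: modulo 2 the odd rows
are orthonormal and the even rows are orthogonal to every row, so the overlaps `coord G` with the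
odd rows label the cosets of 𝒢₀ in 𝒢 (`add_oddComb_mem_evenSpace_iff`) and of 𝒢^⊥ in 𝒢₀^⊥
(`add_oddComb_mem_dual_rowSpace_iff`), without any linear independence of the rows. The cubic one:
expand |∑ xᵢ fⁱ| by inclusion-exclusion modulo 8. Triple terms carry 4 times an even overlap and
vanish, pair terms carry 2 times an even overlap and give controlled-Z phases, and what is left of
the linear terms after keeping one `omega8` per odd row is a power of S
(`omega8_phase_mem_cliffordPhases`). This produces U.

Injection with the noisy ancilla is exactly the gate T followed by independent Z errors
(`injectT_eq_noisyT`). Since U is diagonal, it commutes with these errors, and η₂ is a mixture of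
the states Z(f)|A̅⟩ weighted by `errProb`. Each is a joint eigenvector of X(g), g ∈ 𝒢₀, with sign
(-1)^{f·g}. It survives post-selection exactly when f ∈ 𝒢₀^⊥, and is then the encoded |A_x⟩ with x =
`coord G f` (`gateZ_mulVec_ketEncodedA`). Collecting the errors by x gives `pOut`.

The weight enumerators come from the MacWilliams identity (`sum_errProb_dual`), the Fourier
transform of the product distribution `errProb`. All weights in 𝒢₀ are even, so P_s ≥ 1/|𝒢₀| for
every p. Hence dividing by P_s costs only a constant, and the order p^d is that of the lightest
undetected logical error. -/

namespace MagicDistill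

/-! ### Signs and weights -/

lemma zmod_two_cases (s : ZMod 2) : s = 0 ∨ s = 1 := by
  revert s; decide

/-- The nontrivial additive character of `ZMod 2`. -/
def sgn : AddChar (ZMod 2) ℂ where
  toFun s := if s = 0 then 1 else -1
  map_zero_eq_one' := by simp
  map_add_eq_mul' s t := by
    rcases zmod_two_cases s with rfl | rfl <;> rcases zmod_two_cases t with rfl | rfl <;>
      simp [show (1 + 1 : ZMod 2) = 0 from by decide]

lemma sgn_apply (s : ZMod 2) : sgn s = if s = 0 then 1 else -1 := rfl

@[simp] lemma sgn_one : sgn 1 = -1 := by simp [sgn_apply]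

lemma sgn_mul_self (s : ZMod 2) : sgn s * sgn s = 1 := by
  rcases zmod_two_cases s with rfl | rfl <;> simp

@[simp] lemma star_sgn (s : ZMod 2) : (starRingEnd ℂ) (sgn s) = sgn s := by
  rcases zmod_two_cases s with rfl | rfl <;> simp

lemma bits_add_self {n : ℕ} (f : Bits n) : f + f = 0 := funext fun j => CharTwo.add_self_eq_zero (f j)

lemma bits_sub {n : ℕ} (f g : Bits n) : f - g = f + g := funext fun j => CharTwo.sub_eq_add (f j) (g j)

lemma prod_ite_zero {n : ℕ} {R : Type*} [CommMonoid R] (y : Bits n) (a b : R) :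
    ∏ j, (if y j = 0 then a else b) = a ^ (n - hammingNorm y) * b ^ hammingNorm y := by
  rw [Finset.prod_ite, Finset.prod_const, Finset.prod_const]
  congr 2
  have h := Finset.card_filter_add_card_filter_not (s := (Finset.univ : Finset (Fin n)))
    (fun j => y j = 0)
  rw [Finset.card_univ, Fintype.card_fin] at h
  unfold hammingNorm
  simp only [ne_eq]
  omega

lemma errProb_eq_prod {n : ℕ} (p : ℝ) (f : Bits n) :
    errProb p f = ∏ j, (if f j = 0 then 1 - p else p) := (prod_ite_zero f _ _).symm

lemma hammingNorm_eq_sum_val {n : ℕ} (y : Bits n) : hammingNorm y = ∑ j, (y j).val := by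
  unfold hammingNorm
  rw [Finset.card_filter]
  refine Finset.sum_congr rfl fun j _ => ?_
  rcases zmod_two_cases (y j) with h | h <;> simp [h, ZMod.val_one]

/-- This is needed over the integers, not only modulo 2: it is what allows weights to be tracked
modulo 8. -/
lemma hammingNorm_add_add {n : ℕ} (u v : Bits n) :
    hammingNorm (u + v) + 2 * hammingNorm (u * v) = hammingNorm u + hammingNorm v := by
  simp only [hammingNorm_eq_sum_val, Finset.mul_sum, ← Finset.sum_add_distrib]
  refine Finset.sum_congr rfl fun j _ => ?_
  simp only [Pi.add_apply, Pi.mul_apply]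
  generalize u j = s
  generalize v j = t
  revert s t
  decide

lemma natCast_hammingNorm {n : ℕ} (y : Bits n) : (hammingNorm y : ZMod 2) = ∑ j, y j := by
  simp [hammingNorm_eq_sum_val]

lemma natCast_hammingNorm_mul {n : ℕ} (u v : Bits n) :
    (hammingNorm (u * v) : ZMod 2) = u ⬝ᵥ v := by
  simp [natCast_hammingNorm, dotProduct]

lemma bits_mul_self {n : ℕ} (u : Bits n) : u * u = u := by
  funext j
  simp only [Pi.mul_apply]
  rcases zmod_two_cases (u j) with h | h <;> simp [h]

lemma dotProduct_self_eq {n : ℕ} (u : Bits n) : u ⬝ᵥ u = (hammingNorm u : ZMod 2) := by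
  rw [← natCast_hammingNorm_mul, bits_mul_self]

lemma sgn_dotProduct {n : ℕ} (f y : Bits n) : sgn (f ⬝ᵥ y) = ∏ j, sgn (f j * y j) := by
  exact map_prod sgn.toMonoidHom (fun j => Multiplicative.ofAdd (f j * y j)) Finset.univ

/-! ### Matrix entries of the gates -/

lemma gateX_pow_apply (f s t : ZMod 2) : (gateX ^ f.val) s t = if s = t + f then 1 else 0 := by
  rcases zmod_two_cases f with rfl | rfl
  · simp [Matrix.one_apply]
  · simp [ZMod.val_one, gateX]

lemma opString_gateX_apply {n : ℕ} (f y z : Bits n) :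
    opString gateX f y z = if y = z + f then 1 else 0 := by
  simp only [opString, tensor, Matrix.of_apply, gateX_pow_apply]
  rw [Finset.prod_ite_zero]
  simp [funext_iff]

lemma opString_gateX_mulVec {n : ℕ} (f : Bits n) (v : Bits n → ℂ) (y : Bits n) :
    (opString gateX f *ᵥ v) y = v (y + f) := by
  simp only [mulVec, dotProduct, opString_gateX_apply, ite_mul, one_mul, zero_mul]
  rw [Finset.sum_eq_single (y + f)]
  · simp [add_assoc, bits_add_self]
  · intro z _ hz
    rw [if_neg]
    rintro rfl
    exact hz (by simp [add_assoc, bits_add_self])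
  · simp

lemma tensor_diagonal {n : ℕ} (d : Fin n → ZMod 2 → ℂ) :
    tensor (fun j => Matrix.diagonal (d j)) = Matrix.diagonal (tensorVec d) := by
  ext y z
  simp only [tensor, Matrix.of_apply, Matrix.diagonal_apply, tensorVec]
  rw [Finset.prod_ite_zero]
  simp [funext_iff]

lemma gateZ_pow (f : ZMod 2) : gateZ ^ f.val = Matrix.diagonal fun s => sgn (f * s) := by
  rcases zmod_two_cases f with rfl | rfl
  · simp
  · simp [ZMod.val_one, gateZ, sgn_apply]

lemma opString_gateZ {n : ℕ} (f : Bits n) :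
    opString gateZ f = Matrix.diagonal fun y => sgn (f ⬝ᵥ y) := by
  simp only [opString, gateZ_pow, tensor_diagonal, sgn_dotProduct]
  rfl

lemma transT_eq_diagonal (n : ℕ) :
    transT n = Matrix.diagonal fun y => omega8 ^ hammingNorm y := by
  simp only [transT, gateT, tensor_diagonal]
  congr 1
  funext y
  rw [tensorVec, prod_ite_zero, one_pow, one_mul]

lemma omega8_eq_exp : omega8 = Complex.exp ((Real.pi / 4 : ℝ) * Complex.I) := by
  unfold omega8; congr 1; push_cast; ring

lemma omega8_sq : omega8 ^ 2 = Complex.I := by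
  rw [omega8_eq_exp, ← Complex.exp_nat_mul]
  convert Complex.exp_pi_div_two_mul_I using 2
  push_cast; ring

lemma omega8_pow_eight : omega8 ^ 8 = 1 := by
  rw [show (8 : ℕ) = 2 * 4 from rfl, pow_mul, omega8_sq, Complex.I_pow_four]

lemma omega8_mul_star : omega8 * (starRingEnd ℂ) omega8 = 1 := by
  rw [Complex.mul_conj, Complex.normSq_eq_norm_sq, omega8_eq_exp, Complex.norm_exp_ofReal_mul_I]
  simp

lemma ketA_apply (α s : ZMod 2) :
    ketA α s = sgn (α * s) * omega8 ^ s.val * ((Real.sqrt 2 : ℝ) : ℂ)⁻¹ := by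
  simp only [ketA, gateZ_pow, gateT, ketPlus, mulVec_diagonal]
  rcases zmod_two_cases s with rfl | rfl <;>
    simp [ZMod.val_one, mul_assoc]

lemma sqrt_two_inv_mul_self :
    ((Real.sqrt 2 : ℝ) : ℂ)⁻¹ * ((Real.sqrt 2 : ℝ) : ℂ)⁻¹ = 1 / 2 := by
  rw [← mul_inv, ← Complex.ofReal_mul, Real.mul_self_sqrt (by norm_num)]
  norm_num

lemma ketA_mul_star (α s : ZMod 2) : ketA α s * (starRingEnd ℂ) (ketA α s) = 1 / 2 := by
  rw [ketA_apply]
  simp only [map_mul, map_pow, star_sgn, map_inv₀, Complex.conj_ofReal]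
  calc _ = (sgn (α * s) * sgn (α * s)) * (omega8 * (starRingEnd ℂ) omega8) ^ s.val *
      (((Real.sqrt 2 : ℝ) : ℂ)⁻¹ * ((Real.sqrt 2 : ℝ) : ℂ)⁻¹) := by rw [mul_pow]; ring
    _ = _ := by rw [sgn_mul_self, omega8_mul_star, sqrt_two_inv_mul_self]; simp

lemma rawAncilla_apply (p : ℝ) (s t : ZMod 2) :
    rawAncilla p s t = 1 / 2 * (omega8 ^ s.val * (starRingEnd ℂ) omega8 ^ t.val) *
      ((1 - p : ℂ) + p * sgn (s + t)) := by
  simp only [rawAncilla, ketbra, Matrix.add_apply, Matrix.smul_apply, vecMulVec_apply,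
    Pi.star_apply, ketA_apply, smul_eq_mul, star_mul', RCLike.star_def, map_pow, star_sgn,
    map_inv₀, Complex.conj_ofReal, zero_mul, one_mul, AddChar.map_zero_eq_one,
    AddChar.map_add_eq_mul]
  rw [← sqrt_two_inv_mul_self]
  push_cast
  ring

lemma ketbra_mulVec {ι κ : Type*} [Fintype ι] (M : Matrix κ ι ℂ) (v : ι → ℂ) :
    M * ketbra v * Mᴴ = ketbra (M *ᵥ v) := by
  rw [ketbra, ketbra, Matrix.mul_vecMulVec, Matrix.vecMulVec_mul, star_mulVec]

lemma ketbra_smul {ι : Type*} (c : ℂ) (v : ι → ℂ) :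
    ketbra (c • v) = (c * (starRingEnd ℂ) c) • ketbra v := by
  ext i j
  simp only [ketbra, vecMulVec_apply, Pi.smul_apply, Pi.star_apply, Matrix.smul_apply,
    smul_eq_mul, star_mul', RCLike.star_def]
  ring

/-! ### The noisy transversal gate -/

lemma prod_sum_bits {n : ℕ} (F : Fin n → ZMod 2 → ℂ) :
    ∏ j, ∑ s, F j s = ∑ f : Bits n, ∏ j, F j (f j) := by
  rw [Finset.prod_univ_sum]
  simp

/-- The Fourier transform of a product distribution factors over the bits. It serves twice: for the
noise channel and for the MacWilliams identity. -/
lemma prod_add_mul_sgn {n : ℕ} (p : ℝ) (y : Bits n) :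
    ∏ j, ((1 - p : ℂ) + p * sgn (y j)) =
      ∑ f : Bits n, ((errProb p f : ℝ) : ℂ) * sgn (f ⬝ᵥ y) := by
  have h1 : ∀ j, ((1 - p : ℂ) + p * sgn (y j)) =
      ∑ s : ZMod 2, (if s = 0 then (1 - p : ℂ) else p) * sgn (s * y j) := by
    intro j
    rw [show (Finset.univ : Finset (ZMod 2)) = {0, 1} from rfl, Finset.sum_pair (by decide)]
    simp
  simp only [h1, prod_sum_bits, Finset.prod_mul_distrib, sgn_dotProduct, errProb_eq_prod]
  refine Finset.sum_congr rfl fun f _ => ?_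
  congr 1
  push_cast
  refine Finset.prod_congr rfl fun j _ => ?_
  split_ifs <;> simp

/-- Random Z errors damp the entry (y, z) by the Fourier transform of `errProb` at y + z, so the
channel acts entrywise and factors over qubits. -/
lemma noisyT_apply {n : ℕ} (p : ℝ) (η : Op n) (y z : Bits n) :
    noisyT p η y z = (omega8 ^ hammingNorm y * (starRingEnd ℂ) omega8 ^ hammingNorm z) *
      η y z * ∏ j, ((1 - p : ℂ) + p * sgn (y j + z j)) := by
  have h : ∏ j, ((1 - p : ℂ) + p * sgn (y j + z j)) =
      ∑ f : Bits n, ((errProb p f : ℝ) : ℂ) * (sgn (f ⬝ᵥ y) * sgn (f ⬝ᵥ z)) := by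
    simp only [← AddChar.map_add_eq_mul, ← dotProduct_add]
    exact prod_add_mul_sgn p (y + z)
  rw [h, noisyT, Matrix.sum_apply, Finset.mul_sum]
  refine Finset.sum_congr rfl fun f _ => ?_
  simp only [opString_gateZ, transT_eq_diagonal, Matrix.smul_apply, smul_eq_mul,
    Matrix.diagonal_conjTranspose, Matrix.mul_diagonal, Matrix.diagonal_mul, Pi.star_apply,
    star_pow, RCLike.star_def]
  ring

lemma opString_SX_apply {n : ℕ} (s y z : Bits n) :
    opString (gateS * gateX) s y z =
      if y = z + s then ∏ j, (if y j = 0 then 1 else Complex.I ^ (s j).val) else 0 := by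
  have h : ∀ a b c : ZMod 2, ((gateS * gateX) ^ a.val) b c =
      if b = c + a then (if b = 0 then 1 else Complex.I ^ a.val) else 0 := by
    intro a b c
    rcases zmod_two_cases a with rfl | rfl
    · simp [Matrix.one_apply]
    · simp [ZMod.val_one, gateS, gateX]
  simp only [opString, tensor, Matrix.of_apply, h]
  rw [Finset.prod_ite_zero]
  simp [funext_iff]

/-- Outcome s and final label y determine the input: `SX` flips the ancilla where s is 1, so it was
y + s, and the CNOT then forces the data label to be y. -/
lemma injectKraus_apply {n : ℕ} (s y : Bits n) (v : Bits n × Bits n) :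
    injectKraus s y v =
      if v = (y, y + s) then ∏ j, (if y j = 0 then 1 else Complex.I ^ (s j).val) else 0 := by
  obtain ⟨d, a⟩ := v
  have h1 : ∀ z : Bits n, (readOut s * transCNOT n) z (d, a) =
      if z = a ∧ s = d + a then 1 else 0 := by
    intro z
    rw [Matrix.mul_apply, Finset.sum_eq_single (s, z)]
    · simp [readOut, transCNOT]
    · rintro ⟨b, c⟩ _ hne
      simp only [readOut, Matrix.of_apply]
      rw [if_neg, zero_mul]
      rintro ⟨rfl, rfl⟩
      exact hne rfl
    · simp
  rw [injectKraus, Matrix.mul_assoc, Matrix.mul_apply, Finset.sum_eq_single a]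
  · rw [h1, opString_SX_apply]
    by_cases hy : y = a + s
    · subst hy
      have e : (s = d + a) ↔ d = a + s := by
        constructor
        · rintro rfl; rw [add_comm d a, ← add_assoc, bits_add_self, zero_add]
        · rintro rfl; rw [add_comm a s, add_assoc, bits_add_self, add_zero]
      simp [e, Prod.ext_iff, add_assoc, bits_add_self]
    · rw [if_neg hy, zero_mul, if_neg]
      intro h
      rw [Prod.mk.injEq] at h
      apply hy
      rw [h.2, add_assoc, bits_add_self, add_zero]
  · intro z _ hz
    rw [h1, if_neg (fun h => hz h.1), mul_zero]
  · simp

lemma injectT_apply {n : ℕ} (η σ : Op n) (y z : Bits n) :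
    injectT η σ y z = η y z * ∑ s : Bits n,
      (∏ j, (if y j = 0 then 1 else Complex.I ^ (s j).val)) *
      (∏ j, (if z j = 0 then 1 else (-Complex.I) ^ (s j).val)) * σ (y + s) (z + s) := by
  rw [injectT, Matrix.sum_apply, Finset.mul_sum]
  refine Finset.sum_congr rfl fun s _ => ?_
  rw [Matrix.mul_apply, Finset.sum_eq_single (z, z + s)]
  · rw [Matrix.mul_apply, Finset.sum_eq_single (y, y + s)]
    · simp only [injectKraus_apply, Matrix.conjTranspose_apply, if_true, kroneckerMap_apply,
        RCLike.star_def, map_prod, apply_ite (starRingEnd ℂ), map_one, map_pow, Complex.conj_I]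
      ring
    · intro v _ hv
      rw [injectKraus_apply, if_neg hv, zero_mul]
    · simp
  · intro v _ hv
    rw [Matrix.conjTranspose_apply, injectKraus_apply, if_neg hv, star_zero, mul_zero]
  · simp

lemma omega8_pow_val_prod {n : ℕ} (w : ℂ) (y : Bits n) :
    w ^ hammingNorm y = ∏ j, w ^ (y j).val := by
  rw [Finset.prod_pow_eq_pow_sum, hammingNorm_eq_sum_val]

lemma star_omega8_mul_I : (starRingEnd ℂ) omega8 * Complex.I = omega8 := by
  rw [← omega8_sq]
  linear_combination omega8 * omega8_mul_star

/-- Both sides multiply `η y z` by a factor that is a product over qubits, so one qubit suffices. -/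
lemma injectT_eq_noisyT {n : ℕ} (p : ℝ) (η : Op n) :
    injectT η (rawAncillas n p) = noisyT p η := by
  ext y z
  rw [injectT_apply, noisyT_apply, mul_comm _ (η y z), mul_assoc]
  congr 1
  simp only [rawAncillas, tensor, Matrix.of_apply, ← Finset.prod_mul_distrib,
    omega8_pow_val_prod]
  -- The one-qubit identity, summed over both measurement outcomes; the `SX` correction makes the
  -- outcome-1 term equal to the outcome-0 term.
  have key : ∀ j, ∑ s : ZMod 2, ((if y j = 0 then 1 else Complex.I ^ s.val) *
      (if z j = 0 then 1 else (-Complex.I) ^ s.val) * rawAncilla p (y j + s) (z j + s)) =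
      omega8 ^ (y j).val * (starRingEnd ℂ) omega8 ^ (z j).val *
        ((1 - p : ℂ) + p * sgn (y j + z j)) := by
    intro j
    rw [show (Finset.univ : Finset (ZMod 2)) = {0, 1} from rfl, Finset.sum_pair (by decide)]
    have h1 := omega8_mul_star
    have h2 := star_omega8_mul_I
    have h3 : omega8 * -Complex.I = (starRingEnd ℂ) omega8 := by
      linear_combination Complex.I * h2 - (starRingEnd ℂ) omega8 * Complex.I_mul_I
    have h4 : (1 + 1 : ZMod 2) = 0 := by decide
    simp only [rawAncilla_apply]
    rcases zmod_two_cases (y j) with h | h <;> rcases zmod_two_cases (z j) with h' | h' <;>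
      simp only [h, h', h4, ZMod.val_zero, ZMod.val_one, add_zero, zero_add, if_true, pow_zero,
        pow_one, one_ne_zero, if_false, mul_one, one_mul, AddChar.map_zero_eq_one, sgn_one]
    · linear_combination (1 / 2 : ℂ) * h1
    · linear_combination (1 / 2 : ℂ) * (1 - 2 * p) * h3
    · linear_combination (1 / 2 : ℂ) * (1 - 2 * p) * h2
    · linear_combination (1 / 2 : ℂ) * (-1 * Complex.I_mul_I - h1)
  rw [← Finset.prod_congr rfl fun j _ => key j, prod_sum_bits]
  rfl

/-! ### Linear algebra of triorthogonal matrices -/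

lemma mem_dual {n : ℕ} {W : Submodule (ZMod 2) (Bits n)} {f : Bits n} :
    f ∈ dual W ↔ ∀ g ∈ W, f ⬝ᵥ g = 0 := Iff.rfl

@[simp] lemma mem_elems {n : ℕ} {W : Submodule (ZMod 2) (Bits n)} {f : Bits n} :
    f ∈ elems W ↔ f ∈ W := by
  simp [elems]

lemma card_elems {n : ℕ} (W : Submodule (ZMod 2) (Bits n)) :
    (elems W).card = Nat.card W := by
  rw [elems, ← Set.ncard_eq_toFinset_card]
  rfl

lemma mem_dual_span {n : ℕ} {S : Set (Bits n)} {f : Bits n} :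
    f ∈ dual (Submodule.span (ZMod 2) S) ↔ ∀ g ∈ S, f ⬝ᵥ g = 0 := by
  refine ⟨fun h g hg => h g (Submodule.subset_span hg), fun h g hg => ?_⟩
  induction hg using Submodule.span_induction with
  | mem g hg => exact h g hg
  | zero => exact dotProduct_zero f
  | add a b _ _ ha hb => rw [dotProduct_add, ha, hb, add_zero]
  | smul c a _ ha => rw [dotProduct_smul, ha, smul_zero]

lemma mem_dual_sup {n : ℕ} {V W : Submodule (ZMod 2) (Bits n)} {f : Bits n} :
    f ∈ dual (V ⊔ W) ↔ f ∈ dual V ∧ f ∈ dual W := by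
  refine ⟨fun h => ⟨fun g hg => h g (Submodule.mem_sup_left hg),
    fun g hg => h g (Submodule.mem_sup_right hg)⟩, fun h g hg => ?_⟩
  obtain ⟨v, hv, w, hw, rfl⟩ := Submodule.mem_sup.1 hg
  rw [dotProduct_add, h.1 v hv, h.2 w hw, add_zero]

section Rows

variable {k r n : ℕ} {G : Matrix (Fin (k + r)) (Fin n) (ZMod 2)}

lemma IsTriorthogonal.row_dotProduct_row {m n : ℕ} {G : Matrix (Fin m) (Fin n) (ZMod 2)}
    (hG : IsTriorthogonal G) {i j : Fin m} (h : i ≠ j) : G i ⬝ᵥ G j = 0 := by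
  rcases lt_or_gt_of_ne h with h | h
  · exact hG.pair i j h
  · rw [dotProduct_comm]; exact hG.pair j i h

lemma IsTriorthogonal.triple_of_ne {m n : ℕ} {G : Matrix (Fin m) (Fin n) (ZMod 2)}
    (hG : IsTriorthogonal G) {a b c : Fin m} (hab : a ≠ b) (hac : a ≠ c) (hbc : b ≠ c) :
    ∑ j, G a j * G b j * G c j = 0 := by
  rcases lt_or_gt_of_ne hab with h | h <;> rcases lt_or_gt_of_ne hac with h' | h' <;>
    rcases lt_or_gt_of_ne hbc with h'' | h''
  · exact hG.triple a b c h h''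
  · rw [← hG.triple a c b h' h'']; exact Finset.sum_congr rfl fun _ _ => by ring
  · exact absurd (h.trans h'') h'.not_gt
  · rw [← hG.triple c a b h' h]; exact Finset.sum_congr rfl fun _ _ => by ring
  · rw [← hG.triple b a c h h']; exact Finset.sum_congr rfl fun _ _ => by ring
  · exact absurd (h.trans h') h''.not_gt
  · rw [← hG.triple b c a h'' h']; exact Finset.sum_congr rfl fun _ _ => by ring
  · rw [← hG.triple c b a h'' h]; exact Finset.sum_congr rfl fun _ _ => by ring

lemma even_iff_natCast (m : ℕ) : Even m ↔ (m : ZMod 2) = 0 :=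
  (ZMod.natCast_eq_zero_iff_even).symm

lemma oddRow_dotProduct_oddRow (hG : IsTriorthogonal G)
    (hodd : ∀ a : Fin k, Odd (hammingNorm (oddRow G a))) (a b : Fin k) :
    oddRow G a ⬝ᵥ oddRow G b = if a = b then 1 else 0 := by
  split_ifs with h
  · subst h
    rw [dotProduct_self_eq]
    exact ZMod.natCast_eq_one_iff_odd.2 (hodd a)
  · exact hG.row_dotProduct_row fun e => h (Fin.castAdd_injective k r e)

lemma evenRow_dotProduct_row (hG : IsTriorthogonal G)
    (heven : ∀ b : Fin r, Even (hammingNorm (evenRow G b))) (b : Fin r) (i : Fin (k + r)) :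
    evenRow G b ⬝ᵥ G i = 0 := by
  by_cases h : Fin.natAdd k b = i
  · subst h
    change evenRow G b ⬝ᵥ evenRow G b = 0
    rw [dotProduct_self_eq]
    exact (even_iff_natCast _).1 (heven b)
  · exact hG.row_dotProduct_row h

/-- The overlaps of `y` with the odd rows. -/
def coord (G : Matrix (Fin (k + r)) (Fin n) (ZMod 2)) (y : Bits n) : Bits k :=
  fun a => y ⬝ᵥ oddRow G a

lemma coord_add (y z : Bits n) : coord G (y + z) = coord G y + coord G z :=
  funext fun _ => add_dotProduct _ _ _

lemma oddComb_add (x y : Bits k) : oddComb G (x + y) = oddComb G x + oddComb G y := by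
  simp [oddComb, add_smul, Finset.sum_add_distrib]

@[simp] lemma oddComb_zero : oddComb G 0 = 0 := by
  simp [oddComb]

lemma oddComb_smul (c : ZMod 2) (x : Bits k) : oddComb G (c • x) = c • oddComb G x := by
  simp [oddComb, Finset.smul_sum, mul_smul]

lemma dotProduct_oddComb (y : Bits n) (x : Bits k) :
    y ⬝ᵥ oddComb G x = coord G y ⬝ᵥ x := by
  rw [oddComb, dotProduct_sum]
  exact Finset.sum_congr rfl fun a _ => by rw [dotProduct_smul, smul_eq_mul, mul_comm]; rfl

lemma coord_oddComb (hG : IsTriorthogonal G)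
    (hodd : ∀ a : Fin k, Odd (hammingNorm (oddRow G a))) (x : Bits k) :
    coord G (oddComb G x) = x := by
  funext a
  rw [coord, dotProduct_comm, dotProduct_oddComb, dotProduct, Finset.sum_eq_single a]
  · simp [coord, oddRow_dotProduct_oddRow hG hodd]
  · intro b _ hb
    simp [coord, oddRow_dotProduct_oddRow hG hodd, hb.symm]
  · simp

lemma evenSpace_le_rowSpace : evenSpace G ≤ rowSpace G := by
  refine Submodule.span_mono ?_
  rintro _ ⟨b, rfl⟩
  exact ⟨Fin.natAdd k b, rfl⟩

lemma oddRow_mem_rowSpace (a : Fin k) : oddRow G a ∈ rowSpace G :=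
  Submodule.subset_span ⟨Fin.castAdd r a, rfl⟩

lemma oddComb_mem_rowSpace (x : Bits k) : oddComb G x ∈ rowSpace G :=
  Submodule.sum_mem _ fun a _ => Submodule.smul_mem _ _ (oddRow_mem_rowSpace a)

lemma evenSpace_le_dual_rowSpace (hG : IsTriorthogonal G)
    (heven : ∀ b : Fin r, Even (hammingNorm (evenRow G b))) :
    evenSpace G ≤ dual (rowSpace G) := by
  refine Submodule.span_le.2 ?_
  rintro _ ⟨b, rfl⟩
  refine mem_dual_span.2 ?_
  rintro _ ⟨i, rfl⟩
  exact evenRow_dotProduct_row hG heven b i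

lemma dual_rowSpace_le_dual_evenSpace : dual (rowSpace G) ≤ dual (evenSpace G) :=
  fun _ hf g hg => hf g (evenSpace_le_rowSpace hg)

lemma rowSpace_le_dual_evenSpace (hG : IsTriorthogonal G)
    (heven : ∀ b : Fin r, Even (hammingNorm (evenRow G b))) :
    rowSpace G ≤ dual (evenSpace G) := fun f hf g hg => by
  rw [dotProduct_comm]
  exact evenSpace_le_dual_rowSpace hG heven hg f hf

lemma coord_eq_zero_of_mem {y : Bits n} (hy : y ∈ dual (rowSpace G)) : coord G y = 0 :=
  funext fun a => hy _ (oddRow_mem_rowSpace a)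

lemma oddComb_single (a : Fin k) :
    oddComb G (Pi.single a 1) = oddRow G a := by
  rw [oddComb, Finset.sum_eq_single a]
  · simp
  · intro b _ hb; simp [hb]
  · simp

/-- By orthonormality of the odd rows, `oddComb G (coord G y)` is the odd part of y, and in
characteristic 2 adding it removes it. -/
lemma add_oddComb_coord_mem_evenSpace (hG : IsTriorthogonal G)
    (hodd : ∀ a : Fin k, Odd (hammingNorm (oddRow G a)))
    (heven : ∀ b : Fin r, Even (hammingNorm (evenRow G b))) {y : Bits n}
    (hy : y ∈ rowSpace G) : y + oddComb G (coord G y) ∈ evenSpace G := by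
  induction hy using Submodule.span_induction with
  | mem y hy =>
    obtain ⟨i, rfl⟩ := hy
    induction i using Fin.addCases with
    | left a =>
      change oddRow G a + oddComb G (coord G (oddRow G a)) ∈ _
      have h : oddRow G a = oddComb G (Pi.single a 1) := (oddComb_single a).symm
      rw [h, coord_oddComb hG hodd, bits_add_self]
      exact zero_mem _
    | right b =>
      have h : evenRow G b ∈ evenSpace G := Submodule.subset_span ⟨b, rfl⟩
      change evenRow G b + oddComb G (coord G (evenRow G b)) ∈ _
      rw [coord_eq_zero_of_mem (evenSpace_le_dual_rowSpace hG heven h), oddComb_zero, add_zero]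
      exact h
  | zero =>
    rw [coord_eq_zero_of_mem (zero_mem _), oddComb_zero, add_zero]
    exact zero_mem _
  | add y z _ _ hy hz =>
    rw [coord_add, oddComb_add, add_add_add_comm]
    exact add_mem hy hz
  | smul c y _ hy =>
    have h : coord G (c • y) = c • coord G y := funext fun _ => smul_dotProduct _ _ _
    rw [h, oddComb_smul, ← smul_add]
    exact Submodule.smul_mem _ _ hy

lemma add_oddComb_mem_evenSpace_iff (hG : IsTriorthogonal G)
    (hodd : ∀ a : Fin k, Odd (hammingNorm (oddRow G a)))
    (heven : ∀ b : Fin r, Even (hammingNorm (evenRow G b))) {y : Bits n} {x : Bits k} :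
    y + oddComb G x ∈ evenSpace G ↔ y ∈ rowSpace G ∧ coord G y = x := by
  constructor
  · intro h
    have h1 := coord_eq_zero_of_mem (evenSpace_le_dual_rowSpace hG heven h)
    rw [coord_add, coord_oddComb hG hodd, ← bits_sub, sub_eq_zero] at h1
    refine ⟨?_, h1⟩
    have h2 := add_mem (evenSpace_le_rowSpace h) (oddComb_mem_rowSpace (G := G) x)
    rwa [add_assoc, bits_add_self, add_zero] at h2
  · rintro ⟨hy, rfl⟩
    exact add_oddComb_coord_mem_evenSpace hG hodd heven hy

/-- The dual counterpart: an undetected error is determined modulo 𝒢^⊥ by its overlaps with the odd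
rows, which will be its logical Z action. -/
lemma add_oddComb_mem_dual_rowSpace_iff (hG : IsTriorthogonal G)
    (hodd : ∀ a : Fin k, Odd (hammingNorm (oddRow G a)))
    (heven : ∀ b : Fin r, Even (hammingNorm (evenRow G b))) {f : Bits n} {x : Bits k} :
    f + oddComb G x ∈ dual (rowSpace G) ↔ f ∈ dual (evenSpace G) ∧ coord G f = x := by
  constructor
  · intro h
    have h1 := coord_eq_zero_of_mem h
    rw [coord_add, coord_oddComb hG hodd, ← bits_sub, sub_eq_zero] at h1
    refine ⟨?_, h1⟩
    have h2 := add_mem (dual_rowSpace_le_dual_evenSpace h)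
      (rowSpace_le_dual_evenSpace hG heven (oddComb_mem_rowSpace (G := G) x))
    rwa [add_assoc, bits_add_self, add_zero] at h2
  · rintro ⟨hf, rfl⟩
    refine mem_dual_span.2 ?_
    rintro _ ⟨i, rfl⟩
    induction i using Fin.addCases with
    | left a =>
      have h1 : coord G (f + oddComb G (coord G f)) a = 0 := by
        rw [coord_add, coord_oddComb hG hodd, bits_add_self]; rfl
      exact h1
    | right b =>
      have h : evenRow G b ∈ evenSpace G := Submodule.subset_span ⟨b, rfl⟩
      exact add_mem hf (rowSpace_le_dual_evenSpace hG heven (oddComb_mem_rowSpace _)) _ h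

/-! ### The encoded magic state -/

/-- Expanding the product gives one term for each subset x of the X strings. -/
lemma ofFn_prod_mulVec {k n : ℕ} (f : Fin k → Bits n) (w : ℂ) (v : Bits n → ℂ) (y : Bits n) :
    ((List.ofFn fun a => 1 + w • opString gateX (f a)).prod *ᵥ v) y =
      ∑ x : Bits k, w ^ hammingNorm x * v (y + ∑ a, x a • f a) := by
  induction k generalizing y with
  | zero => simp [hammingNorm_eq_sum_val]
  | succ k ih =>
    rw [List.ofFn_succ, List.prod_cons, ← mulVec_mulVec, add_mulVec, one_mulVec, smul_mulVec]
    simp only [Pi.add_apply, Pi.smul_apply, opString_gateX_mulVec, ih, smul_eq_mul]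
    rw [← (Fin.consEquiv fun _ : Fin (k + 1) => ZMod 2).sum_comp, Fintype.sum_prod_type,
      show (Finset.univ : Finset (ZMod 2)) = {0, 1} from rfl, Finset.sum_pair (by decide),
      Finset.mul_sum]
    congr 1
    · refine Finset.sum_congr rfl fun x _ => ?_
      simp [hammingNorm_eq_sum_val, Fin.consEquiv, Fin.sum_univ_succ]
    · refine Finset.sum_congr rfl fun x _ => ?_
      simp [hammingNorm_eq_sum_val, Fin.consEquiv, Fin.sum_univ_succ, ZMod.val_one, pow_add,
        add_assoc, mul_assoc]

lemma ketSpace_apply {n : ℕ} (W : Submodule (ZMod 2) (Bits n)) (y : Bits n) [Decidable (y ∈ W)] :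
    ketSpace W y = if y ∈ W then 1 else 0 := by
  simp [ketSpace, Set.indicator_apply]

open Classical in
-- In the expansion only x = `coord G y` lands in 𝒢₀, so the encoded state is a pure phase function
-- on 𝒢.
lemma ketEncodedA_apply (hG : IsTriorthogonal G)
    (hodd : ∀ a : Fin k, Odd (hammingNorm (oddRow G a)))
    (heven : ∀ b : Fin r, Even (hammingNorm (evenRow G b))) (y : Bits n) :
    ketEncodedA G y = if y ∈ rowSpace G then omega8 ^ hammingNorm (coord G y) else 0 := by
  rw [ketEncodedA, ofFn_prod_mulVec]
  change ∑ x, omega8 ^ hammingNorm x * ketSpace (evenSpace G) (y + oddComb G x) = _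
  simp only [ketSpace_apply, add_oddComb_mem_evenSpace_iff hG hodd heven]
  by_cases hy : y ∈ rowSpace G <;> simp [hy]

end Rows

/-! ### Diagonal Clifford phases -/

/-- The functions `φ` such that the diagonal operator with entries `φ` is composed of
controlled-`Z` and `S` gates. -/
def cliffordPhases (n : ℕ) : Submonoid (Bits n → ℂ) :=
  (diagClifford n).comap (Matrix.diagonalRingHom (Bits n) ℂ : (Bits n → ℂ) →* Op n)

lemma mem_cliffordPhases {n : ℕ} {φ : Bits n → ℂ} :
    φ ∈ cliffordPhases n ↔ Matrix.diagonal φ ∈ diagClifford n := Iff.rfl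

lemma gateSAt_eq_diagonal {n : ℕ} (j : Fin n) :
    gateSAt j = Matrix.diagonal fun y => Complex.I ^ (y j).val := by
  have h : (Function.update (fun _ : Fin n => (1 : Matrix (ZMod 2) (ZMod 2) ℂ)) j gateS) =
      fun i => Matrix.diagonal fun s => if i = j then Complex.I ^ s.val else 1 := by
    funext i
    by_cases hi : i = j
    · subst hi
      rw [Function.update_self, gateS]
      congr 1
      funext s
      rcases zmod_two_cases s with rfl | rfl <;> simp [ZMod.val_one]
    · rw [Function.update_of_ne hi]
      simp [hi]
  rw [gateSAt, h, tensor_diagonal]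
  congr 1
  funext y
  simp [tensorVec]

lemma exists_diagonal_of_mem_diagClifford {n : ℕ} {U : Op n} (hU : U ∈ diagClifford n) :
    ∃ φ : Bits n → ℂ, U = Matrix.diagonal φ := by
  induction hU using Submonoid.closure_induction with
  | mem U hU =>
    rcases hU with ⟨j, rfl⟩ | ⟨i, j, _, rfl⟩
    · exact ⟨_, gateSAt_eq_diagonal j⟩
    · exact ⟨_, rfl⟩
  | one => exact ⟨1, Matrix.diagonal_one.symm⟩
  | mul U V _ _ hU hV =>
    obtain ⟨φ, rfl⟩ := hU
    obtain ⟨ψ, rfl⟩ := hV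
    exact ⟨_, Matrix.diagonal_mul_diagonal φ ψ⟩

lemma I_pow_mem_cliffordPhases {n : ℕ} (j : Fin n) :
    (fun y : Bits n => Complex.I ^ (y j).val) ∈ cliffordPhases n := by
  rw [mem_cliffordPhases, ← gateSAt_eq_diagonal]
  exact Submonoid.subset_closure (Or.inl ⟨j, rfl⟩)

lemma sgn_mul_mem_cliffordPhases {n : ℕ} (i j : Fin n) :
    (fun y : Bits n => sgn (y i * y j)) ∈ cliffordPhases n := by
  by_cases h : i = j
  · subst h
    -- On the diagonal the quadratic phase is linear, and S² = Z supplies it.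
    convert pow_mem (I_pow_mem_cliffordPhases i) 2 using 1
    funext y
    simp only [Pi.pow_apply]
    rcases zmod_two_cases (y i) with h | h <;> simp [h, ZMod.val_one]
  · rw [mem_cliffordPhases]
    have e : gateCZ i j = Matrix.diagonal fun y : Bits n => sgn (y i * y j) := by
      rw [gateCZ]
      congr 1
      funext y
      rcases zmod_two_cases (y i) with h | h <;> rcases zmod_two_cases (y j) with h' | h' <;>
        simp [h, h']
    rw [← e]
    exact Submonoid.subset_closure (Or.inr ⟨i, j, h, rfl⟩)

lemma sgn_sum {ι : Type*} (s : Finset ι) (f : ι → ZMod 2) :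
    sgn (∑ i ∈ s, f i) = ∏ i ∈ s, sgn (f i) :=
  map_prod sgn.toMonoidHom (fun i => Multiplicative.ofAdd (f i)) s

lemma sgn_dotProduct_mul_mem_cliffordPhases {n : ℕ} (c d : Bits n) :
    (fun y : Bits n => sgn ((c ⬝ᵥ y) * (d ⬝ᵥ y))) ∈ cliffordPhases n := by
  have h : (fun y : Bits n => sgn ((c ⬝ᵥ y) * (d ⬝ᵥ y))) =
      ∏ i, ∏ j, fun y : Bits n => sgn (c i * d j * (y i * y j)) := by
    funext y
    simp only [dotProduct, Finset.sum_mul_sum, sgn_sum, Finset.prod_apply]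
    refine Finset.prod_congr rfl fun i _ => Finset.prod_congr rfl fun j _ => ?_
    congr 1; ring
  rw [h]
  refine Submonoid.prod_mem _ fun i _ => Submonoid.prod_mem _ fun j _ => ?_
  rcases zmod_two_cases (c i * d j) with h | h
  · simp only [h, zero_mul, AddChar.map_zero_eq_one]
    exact one_mem _
  · simp only [h, one_mul]
    exact sgn_mul_mem_cliffordPhases i j

/-- As integers, val(s + t) = val s + val t - 2 val(st); the carry becomes a controlled-Z sign. -/
lemma I_pow_val_add (s t : ZMod 2) :
    Complex.I ^ (s + t).val = Complex.I ^ s.val * Complex.I ^ t.val * sgn (s * t) := by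
  rcases zmod_two_cases s with rfl | rfl <;> rcases zmod_two_cases t with rfl | rfl <;>
    simp [show (1 + 1 : ZMod 2) = 0 from by decide, ZMod.val_one]

lemma I_pow_dotProduct_mem_cliffordPhases {n : ℕ} (c : Bits n) :
    (fun y : Bits n => Complex.I ^ (c ⬝ᵥ y).val) ∈ cliffordPhases n := by
  have key : ∀ c : Bits n, (fun y : Bits n => Complex.I ^ (c ⬝ᵥ y).val) ∈ cliffordPhases n →
      ∀ d : Bits n, (fun y : Bits n => Complex.I ^ (d ⬝ᵥ y).val) ∈ cliffordPhases n →
      (fun y : Bits n => Complex.I ^ ((c + d) ⬝ᵥ y).val) ∈ cliffordPhases n := by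
    intro c hc d hd
    convert mul_mem (mul_mem hc hd) (sgn_dotProduct_mul_mem_cliffordPhases c d) using 1
    funext y
    simp only [add_dotProduct, I_pow_val_add, Pi.mul_apply]
  have zero : (fun y : Bits n => Complex.I ^ (0 ⬝ᵥ y).val) ∈ cliffordPhases n := by
    simp only [zero_dotProduct, ZMod.val_zero, pow_zero]
    exact one_mem _
  rw [← Finset.univ_sum_single c]
  induction (Finset.univ : Finset (Fin n)) using Finset.induction_on with
  | empty => exact zero
  | insert j s hj ih =>
    rw [Finset.sum_insert hj]
    refine key _ ?_ _ ih
    rcases zmod_two_cases (c j) with h | h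
    · rw [h, Pi.single_zero]
      exact zero
    · simp only [h, single_dotProduct, one_mul]
      exact I_pow_mem_cliffordPhases j

/-- The rows may be dependent, so coordinates on 𝒢 are chosen as a linear section of the combination
map and extended to all of `Bits n`. Linearity in y is what makes the phases below Clifford. -/
lemma exists_mulVec_vecMul_eq {m n : ℕ} (G : Matrix (Fin m) (Fin n) (ZMod 2)) :
    ∃ C : Matrix (Fin m) (Fin n) (ZMod 2), ∀ y ∈ rowSpace G, ∑ i, (C i ⬝ᵥ y) • G i = y := by
  have hr : LinearMap.range (Fintype.linearCombination (ZMod 2) (fun i => (G i : Bits n))) =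
      rowSpace G := Fintype.range_linearCombination (ZMod 2) _
  obtain ⟨L, hL⟩ := LinearMap.exists_rightInverse_of_surjective
    (Fintype.linearCombination (ZMod 2) (fun i => (G i : Bits n))).rangeRestrict
    (LinearMap.range_rangeRestrict _)
  obtain ⟨M, hM⟩ := LinearMap.exists_extend L
  refine ⟨LinearMap.toMatrix' M, fun y hy => ?_⟩
  have h1 : ∀ i, (LinearMap.toMatrix' M) i ⬝ᵥ y = M y i := fun i => by
    have := congrFun (LinearMap.toMatrix'_mulVec M y) i
    exact this
  rw [← hr] at hy
  have h2 : M y = L ⟨y, hy⟩ := by rw [← hM]; rfl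
  have h3 := congrArg Subtype.val (LinearMap.congr_fun hL ⟨y, hy⟩)
  simp only [h1, h2]
  exact h3

/-! ### The Clifford phase that corrects the transversal T-gate -/

section Correction

variable {m n : ℕ} {G : Matrix (Fin m) (Fin n) (ZMod 2)}

/-- Modulo 4, the overlap of row a with a sum of other rows is additive: the corrections are twice
triple overlaps, hence multiples of 4. Each pair overlap is even, so its contribution is a sign. -/
lemma I_pow_hammingNorm_row_mul (hG : IsTriorthogonal G) (x : Bits m) {a : Fin m}
    (s : Finset (Fin m)) (ha : a ∉ s) :
    Complex.I ^ hammingNorm (G a * ∑ i ∈ s, x i • G i : Bits n) =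
      ∏ b ∈ s, sgn (x b) ^ (hammingNorm (G a * G b : Bits n) / 2) := by
  induction s using Finset.induction_on with
  | empty => simp
  | insert b s hb ih =>
    rw [Finset.mem_insert, not_or] at ha
    rw [Finset.sum_insert hb, Finset.prod_insert hb, ← ih ha.2]
    rcases zmod_two_cases (x b) with h | h
    · simp [h]
    · rw [h, one_smul, mul_add, sgn_one]
      have h1 := hammingNorm_add_add (G a * G b : Bits n) (G a * ∑ i ∈ s, x i • G i : Bits n)
      have h2 : Even (hammingNorm (G a * G b : Bits n)) := by
        rw [even_iff_natCast, natCast_hammingNorm_mul]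
        exact hG.row_dotProduct_row ha.1
      have h3 : Even (hammingNorm
          ((G a * G b) * (G a * ∑ i ∈ s, x i • G i) : Bits n)) := by
        rw [even_iff_natCast, natCast_hammingNorm_mul, mul_comm (G a) (∑ i ∈ s, _)]
        -- The repeated factor `G a` is absorbed because bits are idempotent, leaving genuine triple
        -- overlaps.
        have e : ((G a * G b : Bits n) ⬝ᵥ ((∑ i ∈ s, x i • G i) * G a : Bits n)) =
            (G a * G b : Bits n) ⬝ᵥ (∑ i ∈ s, x i • G i : Bits n) := by
          refine Finset.sum_congr rfl fun j _ => ?_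
          simp only [Pi.mul_apply]
          rcases zmod_two_cases (G a j) with h | h <;> simp [h]
        rw [e, dotProduct_sum]
        refine Finset.sum_eq_zero fun c hc => ?_
        rw [dotProduct_smul]
        have : (G a * G b : Bits n) ⬝ᵥ G c = 0 :=
          hG.triple_of_ne ha.1 (fun e => ha.2 (e ▸ hc)) (fun e => hb (e ▸ hc))
        rw [this, smul_zero]
      generalize hammingNorm (G a * G b + G a * ∑ i ∈ s, x i • G i : Bits n) = N at *
      generalize hammingNorm ((G a * G b) * (G a * ∑ i ∈ s, x i • G i) : Bits n) = M at *
      obtain ⟨c, hc⟩ := h3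
      obtain ⟨d, hd⟩ := h2
      have h4 : Complex.I ^ (N + 2 * M) = Complex.I ^ N := by
        rw [hc, pow_add, show 2 * (c + c) = 4 * c by ring, pow_mul, Complex.I_pow_four]
        simp
      rw [← h4, h1, pow_add, hd, show d + d = 2 * d by ring, pow_mul, Complex.I_sq]
      simp

/-- The factor 7 stands for -1 modulo 8, so the phase replaces |y| by the sum of the coordinates on
odd rows. Adding a row of weight A changes the exponent by the even number A % 2 + 7A and by twice
its overlap with the previous sum, that is, by powers of `I`. -/
lemma omega8_phase_mem_cliffordPhases (hG : IsTriorthogonal G)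
    (C : Matrix (Fin m) (Fin n) (ZMod 2)) (s : Finset (Fin m)) :
    (fun y : Bits n => omega8 ^ (∑ i ∈ s, (hammingNorm (G i : Bits n) % 2) * (C i ⬝ᵥ y).val +
      7 * hammingNorm (∑ i ∈ s, (C i ⬝ᵥ y) • G i : Bits n))) ∈ cliffordPhases n := by
  induction s using Finset.induction_on with
  | empty =>
    simp only [Finset.sum_empty, hammingNorm_zero, mul_zero, add_zero, pow_zero]
    exact one_mem _
  | insert a s ha ih =>
    have h1 := pow_mem (I_pow_dotProduct_mem_cliffordPhases (C a))
      ((hammingNorm (G a : Bits n) % 2 + 7 * hammingNorm (G a : Bits n)) / 2)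
    have h2 : ∏ b ∈ s, (fun y : Bits n => sgn ((C a ⬝ᵥ y) * (C b ⬝ᵥ y))) ^
        (hammingNorm (G a * G b : Bits n) / 2) ∈ cliffordPhases n :=
      Submonoid.prod_mem _ fun b _ =>
        pow_mem (sgn_dotProduct_mul_mem_cliffordPhases (C a) (C b)) _
    convert mul_mem ih (mul_mem h1 h2) using 1
    funext y
    simp only [Pi.mul_apply, Pi.pow_apply, Finset.prod_apply, Finset.sum_insert ha]
    rcases zmod_two_cases (C a ⬝ᵥ y) with h | h
    · simp [h]
    · have h3 := I_pow_hammingNorm_row_mul hG (fun i => C i ⬝ᵥ y) s ha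
      simp only [h, one_mul, one_smul, ZMod.val_one, mul_one, pow_one]
      rw [← h3]
      have h4 := hammingNorm_add_add (G a : Bits n) (∑ i ∈ s, (C i ⬝ᵥ y) • G i : Bits n)
      generalize hammingNorm (G a + ∑ i ∈ s, (C i ⬝ᵥ y) • G i : Bits n) = N at *
      generalize hammingNorm (G a * ∑ i ∈ s, (C i ⬝ᵥ y) • G i : Bits n) = M at *
      generalize hammingNorm (∑ i ∈ s, (C i ⬝ᵥ y) • G i : Bits n) = B at *
      generalize hammingNorm (G a : Bits n) = A at *
      generalize ∑ i ∈ s, hammingNorm (G i : Bits n) % 2 * (C i ⬝ᵥ y).val = E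
      -- With -14M ≡ 2M modulo 8, adding 16M keeps the exponents comparable in ℕ without
      -- subtraction.
      have h5 : ∀ e, omega8 ^ e = omega8 ^ (e + 8 * (2 * M)) := fun e => by
        rw [pow_add, pow_mul, omega8_pow_eight, one_pow, mul_one]
      rw [h5, ← omega8_sq, ← pow_mul, ← pow_mul, ← pow_add, ← pow_add]
      congr 1
      omega

end Correction

lemma exists_isCorrecting {k r n : ℕ} {G : Matrix (Fin (k + r)) (Fin n) (ZMod 2)}
    (hG : IsTriorthogonal G)
    (hodd : ∀ a : Fin k, Odd (hammingNorm (oddRow G a)))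
    (heven : ∀ b : Fin r, Even (hammingNorm (evenRow G b))) :
    ∃ U : Op n, IsCorrecting G U := by
  classical
  obtain ⟨C, hC⟩ := exists_mulVec_vecMul_eq G
  refine ⟨_, mem_cliffordPhases.1 (omega8_phase_mem_cliffordPhases hG C Finset.univ), ?_⟩
  funext y
  rw [mulVec_diagonal, transT_eq_diagonal, mulVec_diagonal, ketEncodedA_apply hG hodd heven,
    ketSpace_apply]
  split_ifs with hy
  -- On odd rows the chosen coordinates are forced, since they can be read off by overlaps; only
  -- those on even rows are arbitrary.
  · have hc : ∀ a, coord G y a = C (Fin.castAdd r a) ⬝ᵥ y := by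
      intro a
      have h := congrArg (· ⬝ᵥ oddRow G a) (hC y hy)
      simp only [sum_dotProduct] at h
      rw [coord, ← h, Finset.sum_eq_single (Fin.castAdd r a)]
      · rw [smul_dotProduct]
        change _ • (oddRow G a ⬝ᵥ oddRow G a) = _
        rw [oddRow_dotProduct_oddRow hG hodd]
        simp
      · intro i _ hi
        rw [smul_dotProduct, oddRow, hG.row_dotProduct_row hi, smul_zero]
      · simp
    have hs : ∑ i, (hammingNorm (G i : Bits n) % 2) * (C i ⬝ᵥ y).val =
        hammingNorm (coord G y) := by
      rw [Fin.sum_univ_add, hammingNorm_eq_sum_val, Finset.sum_eq_zero (s := Finset.univ)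
        (f := fun i : Fin r => _), add_zero]
      · refine Finset.sum_congr rfl fun a _ => ?_
        have h : hammingNorm (G (Fin.castAdd r a) : Bits n) % 2 = 1 := Nat.odd_iff.1 (hodd a)
        rw [hc, h, one_mul]
      · intro b _
        have h : hammingNorm (G (Fin.natAdd k b) : Bits n) % 2 = 0 := Nat.even_iff.1 (heven b)
        rw [h, zero_mul]
    -- T contributes |y| and the correction 7|y|; together 8|y| is invisible.
    rw [hs, hC y hy, mul_one, ← pow_add, add_assoc, ← Nat.succ_mul, pow_add, pow_mul,
      omega8_pow_eight, one_pow, mul_one]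
  · simp

/-! ### Character sums and the MacWilliams identity -/

lemma elems_sum_add {n : ℕ} {M : Type*} [AddCommMonoid M] {W : Submodule (ZMod 2) (Bits n)}
    {g : Bits n} (hg : g ∈ W) (F : Bits n → M) :
    ∑ f ∈ elems W, F (f + g) = ∑ f ∈ elems W, F f := by
  refine Finset.sum_nbij' (· + g) (· + g) ?_ ?_ ?_ ?_ ?_
  · intro f hf; simpa using add_mem (mem_elems.1 hf) hg
  · intro f hf; simpa using add_mem (mem_elems.1 hf) hg
  · intro f _; simp [add_assoc, bits_add_self]
  · intro f _; simp [add_assoc, bits_add_self]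
  · intro f _; rfl

open Classical in
-- Off the dual, translation by a g with h · g = 1 turns the sum into its negative.
lemma sum_sgn_elems {n : ℕ} (W : Submodule (ZMod 2) (Bits n)) (h : Bits n) :
    ∑ f ∈ elems W, sgn (h ⬝ᵥ f) = if h ∈ dual W then (Nat.card W : ℂ) else 0 := by
  split_ifs with hh
  · rw [Finset.sum_congr rfl (g := fun _ => (1 : ℂ)), Finset.sum_const, card_elems, nsmul_eq_mul,
      mul_one]
    intro f hf
    rw [hh f (mem_elems.1 hf), AddChar.map_zero_eq_one]
  · rw [mem_dual] at hh
    push Not at hh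
    obtain ⟨g, hg, hne⟩ := hh
    have h1 : h ⬝ᵥ g = 1 := (zmod_two_cases _).resolve_left hne
    have h2 := elems_sum_add hg fun f => sgn (h ⬝ᵥ f)
    simp only [dotProduct_add, AddChar.map_add_eq_mul, h1, sgn_one, mul_neg, mul_one,
      Finset.sum_neg_distrib] at h2
    linear_combination -(1 / 2 : ℂ) * h2

lemma card_pos_submodule {n : ℕ} (W : Submodule (ZMod 2) (Bits n)) : 0 < Nat.card W :=
  Nat.card_pos

/-- The MacWilliams identity: write (1-2p)^{|f|} as the Fourier transform of `errProb`, exchange the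
sums, and use character orthogonality on W. -/
lemma sum_errProb_dual {n : ℕ} (W : Submodule (ZMod 2) (Bits n)) (p : ℝ) :
    ∑ f ∈ elems (dual W), errProb p f =
      (Nat.card W : ℝ)⁻¹ * weightEnum W (1 - 2 * p) := by
  classical
  have hc : (Nat.card W : ℝ) ≠ 0 := Nat.cast_ne_zero.2 (card_pos_submodule W).ne'
  rw [eq_inv_mul_iff_mul_eq₀ hc, weightEnum, ← Complex.ofReal_inj]
  push_cast
  have h : ∀ f : Bits n, (1 - 2 * p : ℂ) ^ hammingNorm f =
      ∑ h : Bits n, ((errProb p h : ℝ) : ℂ) * sgn (h ⬝ᵥ f) := by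
    intro f
    rw [← prod_add_mul_sgn, ← one_mul (_ ^ _), ← one_pow (n - hammingNorm f), ← prod_ite_zero]
    refine Finset.prod_congr rfl fun j _ => ?_
    rw [sgn_apply]
    split_ifs <;> ring
  simp only [h]
  rw [Finset.sum_comm]
  simp only [← Finset.mul_sum, sum_sgn_elems, mul_ite, mul_zero]
  rw [← Finset.sum_filter, Finset.mul_sum]
  refine Finset.sum_congr ?_ fun f _ => mul_comm _ _
  ext f
  simp

/-- MacWilliams at p = 1/2: all error patterns are equally likely, and in the enumerator at 0 only f
= 0 survives. -/
lemma card_mul_card_dual {n : ℕ} (W : Submodule (ZMod 2) (Bits n)) :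
    Nat.card W * Nat.card (dual W) = 2 ^ n := by
  have h := sum_errProb_dual W (1 / 2)
  have h1 : ∀ f : Bits n, errProb (1 / 2) f = (1 / 2) ^ n := fun f => by
    rw [errProb_eq_prod, Finset.prod_congr rfl (g := fun _ => (1 / 2 : ℝ))]
    · simp
    · intro j _; split_ifs <;> norm_num
  have h2 : weightEnum W (1 - 2 * (1 / 2)) = 1 := by
    rw [weightEnum, Finset.sum_eq_single 0]
    · simp
    · intro f _ hf
      rw [show (1 - 2 * (1 / 2) : ℝ) = 0 by norm_num, zero_pow (by simpa using hf)]
    · intro h0; exact absurd (mem_elems.2 (zero_mem W)) h0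
  have hc : (Nat.card W : ℝ) ≠ 0 := Nat.cast_ne_zero.2 (card_pos_submodule W).ne'
  simp only [h1, h2, Finset.sum_const, card_elems, nsmul_eq_mul, mul_one] at h
  have h3 : (Nat.card W : ℝ) * Nat.card (dual W) = 2 ^ n := by
    have h4 : (2 : ℝ) ^ n * (1 / 2) ^ n = 1 := by rw [← mul_pow]; norm_num
    field_simp at h
    linear_combination (2 : ℝ) ^ n * h - (Nat.card W : ℝ) * Nat.card (dual W) * h4
  exact_mod_cast h3

lemma dual_dual {n : ℕ} (W : Submodule (ZMod 2) (Bits n)) : dual (dual W) = W := by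
  have h1 : elems W ⊆ elems (dual (dual W)) := fun f hf => mem_elems.2 fun g hg => by
    rw [dotProduct_comm]
    exact hg f (mem_elems.1 hf)
  have h2 : (elems (dual (dual W))).card ≤ (elems W).card := by
    rw [card_elems, card_elems]
    refine Nat.le_of_mul_le_mul_left (le_of_eq ?_) (card_pos_submodule (dual W))
    rw [card_mul_card_dual, mul_comm, card_mul_card_dual]
  have h3 := Finset.eq_of_subset_of_card_le h1 h2
  ext f
  rw [← mem_elems, ← h3, mem_elems]

/-- The origin of the factor 1/2 in the enumerator formula for the error rate. -/
lemma card_sup_span_singleton {n : ℕ} (W : Submodule (ZMod 2) (Bits n)) {u : Bits n}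
    (hu : u ∉ W) : Nat.card ↥(W ⊔ Submodule.span (ZMod 2) {u}) = 2 * Nat.card W := by
  classical
  have h : elems (W ⊔ Submodule.span (ZMod 2) {u}) =
      elems W ∪ (elems W).image (· + u) := by
    ext f
    simp only [mem_elems, Submodule.mem_sup, Submodule.mem_span_singleton, Finset.mem_union,
      Finset.mem_image]
    constructor
    · rintro ⟨w, hw, _, ⟨c, rfl⟩, rfl⟩
      rcases zmod_two_cases c with rfl | rfl
      · exact Or.inl (by simpa using hw)
      · exact Or.inr ⟨w, hw, by simp⟩
    · rintro (hf | ⟨w, hw, rfl⟩)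
      · exact ⟨f, hf, 0, ⟨0, by simp⟩, by simp⟩
      · exact ⟨w, hw, u, ⟨1, by simp⟩, rfl⟩
  rw [← card_elems, h, Finset.card_union_of_disjoint,
    Finset.card_image_of_injective _ (add_left_injective u), card_elems, two_mul]
  rw [Finset.disjoint_left]
  intro f hf hf'
  obtain ⟨w, hw, rfl⟩ := Finset.mem_image.1 hf'
  apply hu
  have := add_mem (mem_elems.1 hw) (mem_elems.1 hf)
  rwa [← add_assoc, bits_add_self, zero_add] at this

lemma errProb_nonneg {n : ℕ} {p : ℝ} (h0 : 0 ≤ p) (h1 : p ≤ 1) (f : Bits n) :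
    0 ≤ errProb p f :=
  mul_nonneg (pow_nonneg (sub_nonneg.2 h1) _) (pow_nonneg h0 _)

/-! ### The encoder and the projector onto the code space -/

section Code

variable {k r n : ℕ} {G : Matrix (Fin (k + r)) (Fin n) (ZMod 2)}

open Classical in
lemma card_rowSpace_fiber (hG : IsTriorthogonal G)
    (hodd : ∀ a : Fin k, Odd (hammingNorm (oddRow G a)))
    (heven : ∀ b : Fin r, Even (hammingNorm (evenRow G b))) (x : Bits k) :
    (Finset.univ.filter fun y => y ∈ rowSpace G ∧ coord G y = x).card =
      Nat.card (evenSpace G) := by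
  rw [← card_elems]
  refine Finset.card_nbij' (· + oddComb G x) (· + oddComb G x) ?_ ?_ ?_ ?_
  · intro y hy
    simpa [add_oddComb_mem_evenSpace_iff hG hodd heven] using hy
  · intro y hy
    simp only [Finset.coe_filter, Finset.mem_univ, true_and, Set.mem_ofPred_eq]
    rw [← add_oddComb_mem_evenSpace_iff hG hodd heven, add_assoc, bits_add_self, add_zero]
    simpa using hy
  · intro y _; simp [add_assoc, bits_add_self]
  · intro y _; simp [add_assoc, bits_add_self]

lemma card_rowSpace (hG : IsTriorthogonal G)
    (hodd : ∀ a : Fin k, Odd (hammingNorm (oddRow G a)))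
    (heven : ∀ b : Fin r, Even (hammingNorm (evenRow G b))) :
    Nat.card (rowSpace G) = 2 ^ k * Nat.card (evenSpace G) := by
  classical
  rw [← card_elems, Finset.card_eq_sum_card_fiberwise (f := coord G) (t := Finset.univ)
    (fun _ _ => Finset.mem_coe.2 (Finset.mem_univ _))]
  have h : ∀ x, ((elems (rowSpace G)).filter fun y => coord G y = x).card =
      Nat.card (evenSpace G) := fun x => by
    rw [← card_rowSpace_fiber hG hodd heven x]
    congr 1
    ext y
    simp
  simp [h]

lemma sqrt_card_inv_mul_self (m : ℕ) :
    ((Real.sqrt m : ℝ) : ℂ)⁻¹ * ((Real.sqrt m : ℝ) : ℂ)⁻¹ = (m : ℂ)⁻¹ := by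
  rw [← mul_inv, ← Complex.ofReal_mul, Real.mul_self_sqrt (Nat.cast_nonneg m),
    Complex.ofReal_natCast]

open Classical in
lemma encoder_apply (hG : IsTriorthogonal G)
    (hodd : ∀ a : Fin k, Odd (hammingNorm (oddRow G a)))
    (heven : ∀ b : Fin r, Even (hammingNorm (evenRow G b))) (y : Bits n) (x : Bits k) :
    encoder G y x = ((Real.sqrt (Nat.card (evenSpace G)) : ℝ) : ℂ)⁻¹ *
      if y ∈ rowSpace G ∧ coord G y = x then 1 else 0 := by
  rw [encoder, Matrix.of_apply, bits_sub, ketSpace_apply]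
  simp only [add_oddComb_mem_evenSpace_iff hG hodd heven]

/-- The columns are supported on the disjoint fibres of `coord G` in 𝒢, each of size |𝒢₀|. -/
lemma encoder_conjTranspose_mul_self (hG : IsTriorthogonal G)
    (hodd : ∀ a : Fin k, Odd (hammingNorm (oddRow G a)))
    (heven : ∀ b : Fin r, Even (hammingNorm (evenRow G b))) :
    (encoder G)ᴴ * encoder G = 1 := by
  classical
  ext x x'
  have hc : (Nat.card (evenSpace G) : ℂ) ≠ 0 :=
    Nat.cast_ne_zero.2 (card_pos_submodule _).ne'
  have h : ∀ y, star (encoder G y x) * encoder G y x' =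
      if y ∈ rowSpace G ∧ coord G y = x then
        (Nat.card (evenSpace G) : ℂ)⁻¹ * (if x = x' then 1 else 0) else 0 := by
    intro y
    rw [encoder_apply hG hodd heven, encoder_apply hG hodd heven]
    simp only [star_mul', RCLike.star_def, map_inv₀, Complex.conj_ofReal,
      apply_ite (starRingEnd ℂ), map_one, map_zero]
    by_cases h1 : y ∈ rowSpace G
    · by_cases h2 : coord G y = x
      · subst h2
        by_cases h3 : coord G y = x'
        · simp [h1, h3, sqrt_card_inv_mul_self]
        · simp [h1, h3]
      · simp [h2]
    · simp [h1]
  simp only [Matrix.mul_apply, Matrix.conjTranspose_apply, h]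
  rw [← Finset.sum_filter, Finset.sum_const, card_rowSpace_fiber hG hodd heven, nsmul_eq_mul,
    ← mul_assoc, mul_inv_cancel₀ hc, one_mul, Matrix.one_apply]

lemma encoder_mul_conjTranspose (hG : IsTriorthogonal G)
    (hodd : ∀ a : Fin k, Odd (hammingNorm (oddRow G a)))
    (heven : ∀ b : Fin r, Even (hammingNorm (evenRow G b))) :
    encoder G * (encoder G)ᴴ = codeProj G := by
  classical
  ext y z
  have hc : (Nat.card (dual (rowSpace G)) : ℂ) ≠ 0 :=
    Nat.cast_ne_zero.2 (card_pos_submodule _).ne'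
  -- By character orthogonality and `dual_dual`, the average of the Z stabilizers is the indicator
  -- of 𝒢.
  have hz : (Nat.card (dual (rowSpace G)) : ℂ)⁻¹ •
      ∑ g ∈ elems (dual (rowSpace G)), opString gateZ g =
      Matrix.diagonal fun y => if y ∈ rowSpace G then 1 else 0 := by
    ext u v
    simp only [opString_gateZ, Matrix.smul_apply, Matrix.sum_apply, Matrix.diagonal_apply,
      smul_eq_mul]
    by_cases huv : u = v
    · subst huv
      simp only [if_true]
      simp only [dotProduct_comm _ u]
      rw [sum_sgn_elems, dual_dual]
      split_ifs
      · exact inv_mul_cancel₀ hc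
      · exact mul_zero _
    · simp [huv]
  have hx : (∑ f ∈ elems (evenSpace G), opString gateX f) y z =
      if y + z ∈ evenSpace G then 1 else 0 := by
    simp only [Matrix.sum_apply, opString_gateX_apply]
    have e : ∀ f, (y = z + f) ↔ y + z = f := fun f => by
      constructor
      · rintro rfl; rw [add_comm z f, add_assoc, bits_add_self, add_zero]
      · rintro rfl; rw [add_comm y z, ← add_assoc, bits_add_self, zero_add]
    simp only [e, Finset.sum_ite_eq, mem_elems]
  rw [codeProj, hz, Matrix.mul_diagonal, Matrix.smul_apply, hx, Matrix.mul_apply]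
  simp only [Matrix.conjTranspose_apply, encoder_apply hG hodd heven, star_mul',
    RCLike.star_def, map_inv₀, Complex.conj_ofReal, apply_ite (starRingEnd ℂ), map_one, map_zero,
    mul_mul_mul_comm _ _ ((Real.sqrt (Nat.card (evenSpace G)) : ℝ) : ℂ)⁻¹ _,
    sqrt_card_inv_mul_self]
  rw [← Finset.mul_sum, smul_eq_mul, mul_assoc]
  congr 1
  -- Two elements of 𝒢 differ by 𝒢₀ exactly when they have the same `coord`, that is, lie in the
  -- support of the same column.
  have e : (y + z ∈ evenSpace G ∧ z ∈ rowSpace G) ↔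
      (y ∈ rowSpace G ∧ z ∈ rowSpace G ∧ coord G y = coord G z) := by
    have h0 := add_oddComb_mem_evenSpace_iff hG hodd heven (y := y + z) (x := 0)
    rw [oddComb_zero, add_zero, coord_add, ← bits_sub (coord G y), sub_eq_zero] at h0
    rw [h0]
    constructor
    · rintro ⟨⟨h1, h2⟩, h3⟩
      refine ⟨?_, h3, h2⟩
      have := add_mem h1 h3
      rwa [add_assoc, bits_add_self, add_zero] at this
    · rintro ⟨h1, h2, h3⟩
      exact ⟨⟨add_mem h1 h2, h3⟩, h2⟩
  rw [ite_zero_mul_ite_zero, if_congr e rfl rfl]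
  by_cases hy : y ∈ rowSpace G <;> by_cases hz : z ∈ rowSpace G <;> simp [hy, hz, eq_comm]

end Code

lemma gateZ_string_conjTranspose {n : ℕ} (f : Bits n) :
    (opString gateZ f)ᴴ = opString gateZ f := by
  rw [opString_gateZ, Matrix.diagonal_conjTranspose]
  congr 1
  funext y
  exact star_sgn _

lemma ketAs_apply {k : ℕ} (x y : Bits k) :
    ketAs x y = sgn (x ⬝ᵥ y) * omega8 ^ hammingNorm y * (((Real.sqrt 2 : ℝ) : ℂ)⁻¹) ^ k := by
  simp only [ketAs, tensorVec, ketA_apply, Finset.prod_mul_distrib, sgn_dotProduct,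
    omega8_pow_val_prod, Finset.prod_const, Finset.card_univ, Fintype.card_fin]

lemma sum_ketA_mul_star (α : ZMod 2) :
    ∑ s, ketA α s * (starRingEnd ℂ) (ketA α s) = 1 := by
  simp only [ketA_mul_star]
  simp

lemma trace_ketbra_ketAs {k : ℕ} (x : Bits k) : (ketbra (ketAs x)).trace = 1 := by
  have h : ∀ y, (ketbra (ketAs x)) y y = ∏ a, ketA (x a) (y a) *
      (starRingEnd ℂ) (ketA (x a) (y a)) := fun y => by
    simp [ketbra, vecMulVec_apply, ketAs, tensorVec, Finset.prod_mul_distrib]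
  simp only [Matrix.trace, Matrix.diag_apply, h]
  rw [← prod_sum_bits fun a s => ketA (x a) s * (starRingEnd ℂ) (ketA (x a) s)]
  simp [sum_ketA_mul_star]

/-! ### The post-selected state and its decoding -/

section Distill

variable {k r n : ℕ} {G : Matrix (Fin (k + r)) (Fin n) (ZMod 2)}

/-- Translation by g ∈ 𝒢₀ preserves both 𝒢 and `coord G`, so X(g) fixes the encoded state; the sign
comes from anticommutation with Z(f). -/
lemma gateX_mulVec_gateZ_ketEncodedA (hG : IsTriorthogonal G)
    (hodd : ∀ a : Fin k, Odd (hammingNorm (oddRow G a)))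
    (heven : ∀ b : Fin r, Even (hammingNorm (evenRow G b))) (f : Bits n) {g : Bits n}
    (hg : g ∈ evenSpace G) :
    opString gateX g *ᵥ (opString gateZ f *ᵥ ketEncodedA G) =
      sgn (f ⬝ᵥ g) • (opString gateZ f *ᵥ ketEncodedA G) := by
  classical
  funext y
  rw [opString_gateX_mulVec, opString_gateZ, mulVec_diagonal, Pi.smul_apply, mulVec_diagonal,
    ketEncodedA_apply hG hodd heven, ketEncodedA_apply hG hodd heven, coord_add,
    coord_eq_zero_of_mem (evenSpace_le_dual_rowSpace hG heven hg), add_zero, dotProduct_add,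
    AddChar.map_add_eq_mul, if_congr
      (Submodule.add_mem_iff_left _ (evenSpace_le_rowSpace hg)) rfl rfl, smul_eq_mul]
  ring

open Classical in
lemma trivialSyndrome_mulVec (hG : IsTriorthogonal G)
    (hodd : ∀ a : Fin k, Odd (hammingNorm (oddRow G a)))
    (heven : ∀ b : Fin r, Even (hammingNorm (evenRow G b))) (f : Bits n) :
    trivialSyndrome G *ᵥ (opString gateZ f *ᵥ ketEncodedA G) =
      if f ∈ dual (evenSpace G) then opString gateZ f *ᵥ ketEncodedA G else 0 := by
  -- On a joint eigenvector the ordered product of measurement operators is the product of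
  -- eigenvalues, here 0 or 1.
  have aux : ∀ (m : ℕ) (A : Fin m → Op n) (c : Fin m → ℂ) (v : Bits n → ℂ),
      (∀ b, A b *ᵥ v = c b • v) → (List.ofFn A).prod *ᵥ v = (∏ b, c b) • v := by
    intro m
    induction m with
    | zero => intro A c v _; simp
    | succ m ih =>
      intro A c v h
      rw [List.ofFn_succ, List.prod_cons, ← mulVec_mulVec, ih _ (fun b => c b.succ) v
        (fun b => h b.succ), mulVec_smul, h 0, smul_smul, Fin.prod_univ_succ, mul_comm]
  rw [trivialSyndrome, aux r _ (fun b => if f ⬝ᵥ evenRow G b = 0 then 1 else 0)]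
  · rw [Finset.prod_ite_zero, evenSpace, mem_dual_span]
    simp
  · intro b
    have h : evenRow G b ∈ evenSpace G := Submodule.subset_span ⟨b, rfl⟩
    rw [smul_mulVec, add_mulVec, one_mulVec,
      gateX_mulVec_gateZ_ketEncodedA hG hodd heven f h, sgn_apply]
    split_ifs
    · rw [one_smul, ← two_smul ℂ, smul_smul]; norm_num
    · rw [neg_smul, one_smul, add_neg_cancel, smul_zero, zero_smul]

lemma sgn_dotProduct_eq_coord (hG : IsTriorthogonal G)
    (hodd : ∀ a : Fin k, Odd (hammingNorm (oddRow G a)))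
    (heven : ∀ b : Fin r, Even (hammingNorm (evenRow G b))) {f y : Bits n}
    (hf : f ∈ dual (evenSpace G)) (hy : y ∈ rowSpace G) :
    f ⬝ᵥ y = coord G f ⬝ᵥ coord G y := by
  have h := hf _ (add_oddComb_coord_mem_evenSpace hG hodd heven hy)
  rwa [dotProduct_add, dotProduct_oddComb, ← CharTwo.sub_eq_add, sub_eq_zero] at h

/-- The norm of the unnormalized encoded magic state. -/
noncomputable def encodedNorm (G : Matrix (Fin (k + r)) (Fin n) (ZMod 2)) : ℂ :=
  ((Real.sqrt (Nat.card (evenSpace G)) : ℝ) : ℂ) * ((Real.sqrt 2 : ℝ) : ℂ) ^ k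

/-- An undetected Z error acts as the logical Z string given by its overlaps with the odd rows. -/
lemma gateZ_mulVec_ketEncodedA (hG : IsTriorthogonal G)
    (hodd : ∀ a : Fin k, Odd (hammingNorm (oddRow G a)))
    (heven : ∀ b : Fin r, Even (hammingNorm (evenRow G b))) {f : Bits n}
    (hf : f ∈ dual (evenSpace G)) :
    opString gateZ f *ᵥ ketEncodedA G =
      encodedNorm G • (encoder G *ᵥ ketAs (coord G f)) := by
  classical
  have hc : ((Real.sqrt (Nat.card (evenSpace G)) : ℝ) : ℂ) ≠ 0 :=
    Complex.ofReal_ne_zero.2 (Real.sqrt_ne_zero'.2 (Nat.cast_pos.2 (card_pos_submodule _)))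
  have h2 : ((Real.sqrt 2 : ℝ) : ℂ) ≠ 0 :=
    Complex.ofReal_ne_zero.2 (Real.sqrt_ne_zero'.2 (by norm_num))
  funext y
  rw [opString_gateZ, mulVec_diagonal, ketEncodedA_apply hG hodd heven, Pi.smul_apply,
    smul_eq_mul]
  change _ = _ * ∑ x, encoder G y x * ketAs (coord G f) x
  simp only [encoder_apply hG hodd heven, ketAs_apply]
  by_cases hy : y ∈ rowSpace G
  · rw [sgn_dotProduct_eq_coord hG hodd heven hf hy, Finset.sum_eq_single (coord G y)]
    · simp only [hy, true_and, if_true, mul_one, encodedNorm, inv_pow]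
      field_simp
    · intro x _ hx
      rw [if_neg fun h => hx h.2.symm, mul_zero, zero_mul]
    · simp
  · simp [hy]

lemma encoder_conjTranspose_mulVec_gateX (hG : IsTriorthogonal G)
    (hodd : ∀ a : Fin k, Odd (hammingNorm (oddRow G a)))
    (heven : ∀ b : Fin r, Even (hammingNorm (evenRow G b))) {g : Bits n}
    (hg : g ∈ evenSpace G) (v : Bits n → ℂ) :
    (encoder G)ᴴ *ᵥ (opString gateX g *ᵥ v) = (encoder G)ᴴ *ᵥ v := by
  classical
  funext x
  simp only [mulVec, dotProduct, Matrix.conjTranspose_apply]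
  rw [← Equiv.sum_comp (Equiv.addRight g)]
  refine Finset.sum_congr rfl fun y _ => ?_
  have h := opString_gateX_mulVec g v (y + g)
  simp only [mulVec, dotProduct] at h
  rw [Equiv.coe_addRight, h, add_assoc, bits_add_self, add_zero, encoder_apply hG hodd heven,
    encoder_apply hG hodd heven, coord_add,
    coord_eq_zero_of_mem (evenSpace_le_dual_rowSpace hG heven hg), add_zero, if_congr
      (and_congr (Submodule.add_mem_iff_left _ (evenSpace_le_rowSpace hg)) Iff.rfl) rfl rfl]

open Classical in
lemma codeProj_mulVec (hG : IsTriorthogonal G)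
    (hodd : ∀ a : Fin k, Odd (hammingNorm (oddRow G a)))
    (heven : ∀ b : Fin r, Even (hammingNorm (evenRow G b))) (f : Bits n) :
    codeProj G *ᵥ (opString gateZ f *ᵥ ketEncodedA G) =
      if f ∈ dual (evenSpace G) then opString gateZ f *ᵥ ketEncodedA G else 0 := by
  rw [← encoder_mul_conjTranspose hG hodd heven, ← mulVec_mulVec]
  split_ifs with hf
  · rw [gateZ_mulVec_ketEncodedA hG hodd heven hf, mulVec_smul, mulVec_mulVec,
      encoder_conjTranspose_mul_self hG hodd heven, one_mulVec, mulVec_smul]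
  · rw [mem_dual] at hf
    push Not at hf
    obtain ⟨g, hg, hne⟩ := hf
    -- V† absorbs X(g), while a detected error gives eigenvalue -1; hence V† sends the state to its
    -- own negative, which is 0.
    have h := encoder_conjTranspose_mulVec_gateX hG hodd heven hg
      (opString gateZ f *ᵥ ketEncodedA G)
    rw [gateX_mulVec_gateZ_ketEncodedA hG hodd heven f hg,
      (zmod_two_cases _).resolve_left hne, sgn_one, mulVec_smul, neg_smul, one_smul] at h
    have h0 : (encoder G)ᴴ *ᵥ (opString gateZ f *ᵥ ketEncodedA G) = 0 := by
      funext x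
      have := congrFun h x
      simp only [Pi.neg_apply] at this
      rw [Pi.zero_apply]
      linear_combination -(1 / 2 : ℂ) * this
    rw [h0, mulVec_zero]

/-- U is diagonal, so the errors can be moved past it onto the ideal output. -/
lemma etaTwo_eq {U : Op n} (hU : IsCorrecting G U) (p : ℝ) :
    etaTwo G U (rawAncillas n p) = ∑ f : Bits n, ((errProb p f : ℝ) : ℂ) •
      (Nat.card (rowSpace G) : ℂ)⁻¹ • ketbra (opString gateZ f *ᵥ ketEncodedA G) := by
  obtain ⟨φ, hφ⟩ := exists_diagonal_of_mem_diagClifford hU.1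
  rw [etaTwo, injectT_eq_noisyT, noisyT, Matrix.mul_sum, Matrix.sum_mul]
  refine Finset.sum_congr rfl fun f _ => ?_
  have hcomm : U * opString gateZ f = opString gateZ f * U := by
    rw [hφ, opString_gateZ, Matrix.diagonal_mul_diagonal, Matrix.diagonal_mul_diagonal]
    congr 1
    funext y
    exact mul_comm _ _
  rw [← hU.2, mulVec_mulVec, mulVec_mulVec, ← ketbra_mulVec, initState, ← hcomm,
    Matrix.conjTranspose_mul, Matrix.conjTranspose_mul, gateZ_string_conjTranspose]
  simp only [Matrix.mul_smul, Matrix.smul_mul, Matrix.mul_assoc]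

/-- Kept general in `M` so that the measured syndrome and the code projector give the same state on
`etaTwo`, without proving the two operators equal; indeed `trivialSyndrome` contains no Z
stabilizers. -/
lemma sandwich_etaTwo (hG : IsTriorthogonal G)
    (hodd : ∀ a : Fin k, Odd (hammingNorm (oddRow G a)))
    (heven : ∀ b : Fin r, Even (hammingNorm (evenRow G b))) {U : Op n} (hU : IsCorrecting G U)
    (p : ℝ) {M : Op n}
    (hM : ∀ f ∈ dual (evenSpace G),
      M *ᵥ (opString gateZ f *ᵥ ketEncodedA G) = opString gateZ f *ᵥ ketEncodedA G)
    (hM' : ∀ f ∉ dual (evenSpace G), M *ᵥ (opString gateZ f *ᵥ ketEncodedA G) = 0) :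
    M * etaTwo G U (rawAncillas n p) * Mᴴ =
      encoder G * (∑ f ∈ elems (dual (evenSpace G)), ((errProb p f : ℝ) : ℂ) •
        ketbra (ketAs (coord G f))) * (encoder G)ᴴ := by
  have hN : (Nat.card (rowSpace G) : ℂ)⁻¹ *
      (encodedNorm G * (starRingEnd ℂ) (encodedNorm G)) = 1 := by
    have hc : (Nat.card (evenSpace G) : ℂ) ≠ 0 :=
      Nat.cast_ne_zero.2 (card_pos_submodule _).ne'
    have h1 : encodedNorm G * (starRingEnd ℂ) (encodedNorm G) =
        2 ^ k * Nat.card (evenSpace G) := by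
      simp only [encodedNorm, map_mul, map_pow, Complex.conj_ofReal]
      rw [mul_mul_mul_comm, ← mul_pow, ← Complex.ofReal_mul, ← Complex.ofReal_mul,
        Real.mul_self_sqrt (Nat.cast_nonneg _), Real.mul_self_sqrt (by norm_num)]
      push_cast
      ring
    rw [h1, card_rowSpace hG hodd heven]
    push_cast
    exact inv_mul_cancel₀ (mul_ne_zero (pow_ne_zero _ two_ne_zero) hc)
  rw [etaTwo_eq hU, Matrix.mul_sum, Matrix.sum_mul, Matrix.mul_sum, Matrix.sum_mul,
    ← Finset.sum_subset (Finset.subset_univ (elems (dual (evenSpace G))))]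
  · refine Finset.sum_congr rfl fun f hf => ?_
    have hf' := mem_elems.1 hf
    simp only [Matrix.mul_smul, Matrix.smul_mul, ketbra_mulVec]
    rw [hM f hf', gateZ_mulVec_ketEncodedA hG hodd heven hf', ketbra_smul, smul_smul _ _ (ketbra _),
      hN, one_smul]
  · intro f _ hf
    simp only [Matrix.mul_smul, Matrix.smul_mul, ketbra_mulVec]
    rw [hM' f (fun h => hf (mem_elems.2 h))]
    simp [ketbra]

lemma pOut_eq (hG : IsTriorthogonal G)
    (hodd : ∀ a : Fin k, Odd (hammingNorm (oddRow G a)))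
    (heven : ∀ b : Fin r, Even (hammingNorm (evenRow G b))) (p : ℝ) (x : Bits k) :
    pOut G p x = ∑ f ∈ elems (dual (evenSpace G)) with coord G f = x, errProb p f := by
  rw [pOut]
  refine Finset.sum_nbij' (· + oddComb G x) (· + oddComb G x) ?_ ?_ ?_ ?_ fun _ _ => rfl
  · intro f hf
    simp only [Finset.mem_filter, mem_elems]
    rw [← add_oddComb_mem_dual_rowSpace_iff hG hodd heven, add_assoc, bits_add_self, add_zero]
    exact mem_elems.1 hf
  · intro f hf
    rw [mem_elems, add_oddComb_mem_dual_rowSpace_iff hG hodd heven]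
    simpa using hf
  · intro f _; simp [add_assoc, bits_add_self]
  · intro f _; simp [add_assoc, bits_add_self]

/-- The unnormalized output state, a mixture of the states `|A_x⟩`. -/
noncomputable def mixture (G : Matrix (Fin (k + r)) (Fin n) (ZMod 2)) (p : ℝ) : Op k :=
  ∑ x : Bits k, ((pOut G p x : ℝ) : ℂ) • ketbra (ketAs x)

lemma sum_errProb_smul_ketbra (hG : IsTriorthogonal G)
    (hodd : ∀ a : Fin k, Odd (hammingNorm (oddRow G a)))
    (heven : ∀ b : Fin r, Even (hammingNorm (evenRow G b))) (p : ℝ) :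
    ∑ f ∈ elems (dual (evenSpace G)), ((errProb p f : ℝ) : ℂ) • ketbra (ketAs (coord G f)) =
      mixture G p := by
  rw [← Finset.sum_fiberwise _ (coord G), mixture]
  refine Finset.sum_congr rfl fun x _ => ?_
  rw [pOut_eq hG hodd heven, Complex.ofReal_sum, Finset.sum_smul]
  refine Finset.sum_congr rfl fun f hf => ?_
  rw [(Finset.mem_filter.1 hf).2]

lemma postSelected_eq (hG : IsTriorthogonal G)
    (hodd : ∀ a : Fin k, Odd (hammingNorm (oddRow G a)))
    (heven : ∀ b : Fin r, Even (hammingNorm (evenRow G b))) {U : Op n} (hU : IsCorrecting G U)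
    (p : ℝ) :
    postSelected G U (rawAncillas n p) = encoder G * mixture G p * (encoder G)ᴴ := by
  rw [postSelected, sandwich_etaTwo hG hodd heven hU p, sum_errProb_smul_ketbra hG hodd heven]
  · intro f hf; rw [trivialSyndrome_mulVec hG hodd heven, if_pos hf]
  · intro f hf; rw [trivialSyndrome_mulVec hG hodd heven, if_neg hf]

lemma postSelected_eq_codeProj (hG : IsTriorthogonal G)
    (hodd : ∀ a : Fin k, Odd (hammingNorm (oddRow G a)))
    (heven : ∀ b : Fin r, Even (hammingNorm (evenRow G b))) {U : Op n} (hU : IsCorrecting G U)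
    (p : ℝ) :
    postSelected G U (rawAncillas n p) =
      codeProj G * etaTwo G U (rawAncillas n p) * codeProj G := by
  have h : (codeProj G)ᴴ = codeProj G := by
    rw [← encoder_mul_conjTranspose hG hodd heven, Matrix.conjTranspose_mul,
      Matrix.conjTranspose_conjTranspose]
  have h2 := sandwich_etaTwo hG hodd heven hU p (M := codeProj G)
    (fun f hf => by rw [codeProj_mulVec hG hodd heven, if_pos hf])
    (fun f hf => by rw [codeProj_mulVec hG hodd heven, if_neg hf])
  rw [h, sum_errProb_smul_ketbra hG hodd heven] at h2
  rw [h2, postSelected_eq hG hodd heven hU]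

lemma sum_pOut (hG : IsTriorthogonal G)
    (hodd : ∀ a : Fin k, Odd (hammingNorm (oddRow G a)))
    (heven : ∀ b : Fin r, Even (hammingNorm (evenRow G b))) (p : ℝ) :
    ∑ x, pOut G p x = ∑ f ∈ elems (dual (evenSpace G)), errProb p f := by
  simp only [pOut_eq hG hodd heven]
  exact Finset.sum_fiberwise _ _ _

lemma successProb_eq (hG : IsTriorthogonal G)
    (hodd : ∀ a : Fin k, Odd (hammingNorm (oddRow G a)))
    (heven : ∀ b : Fin r, Even (hammingNorm (evenRow G b))) {U : Op n} (hU : IsCorrecting G U)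
    (p : ℝ) :
    successProb G U (rawAncillas n p) = ∑ x, pOut G p x := by
  rw [successProb, postSelected_eq hG hodd heven hU, Matrix.trace_mul_comm, ← Matrix.mul_assoc,
    encoder_conjTranspose_mul_self hG hodd heven, Matrix.one_mul, mixture, Matrix.trace_sum]
  simp only [Matrix.trace_smul, trace_ketbra_ketAs, smul_eq_mul, mul_one]
  rw [← Complex.ofReal_sum, Complex.ofReal_re]

lemma outputState_eq (hG : IsTriorthogonal G)
    (hodd : ∀ a : Fin k, Odd (hammingNorm (oddRow G a)))
    (heven : ∀ b : Fin r, Even (hammingNorm (evenRow G b))) {U : Op n} (hU : IsCorrecting G U)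
    (p : ℝ) :
    outputState G U (rawAncillas n p) =
      ((successProb G U (rawAncillas n p) : ℝ) : ℂ)⁻¹ • mixture G p := by
  have hV := encoder_conjTranspose_mul_self hG hodd heven
  rw [outputState, etaThree, postSelected_eq hG hodd heven hU, Matrix.mul_smul, Matrix.smul_mul]
  congr 1
  calc _ = ((encoder G)ᴴ * encoder G) * mixture G p * ((encoder G)ᴴ * encoder G) := by
        simp only [Matrix.mul_assoc]
    _ = _ := by rw [hV, Matrix.one_mul, Matrix.mul_one]

lemma etaThree_eq (hG : IsTriorthogonal G)
    (hodd : ∀ a : Fin k, Odd (hammingNorm (oddRow G a)))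
    (heven : ∀ b : Fin r, Even (hammingNorm (evenRow G b))) {U : Op n} (hU : IsCorrecting G U)
    (p : ℝ) :
    etaThree G U (rawAncillas n p) =
      encoder G * outputState G U (rawAncillas n p) * (encoder G)ᴴ := by
  rw [outputState_eq hG hodd heven hU, etaThree, postSelected_eq hG hodd heven hU,
    Matrix.mul_smul, Matrix.smul_mul]

/-- Even exponents make every term nonnegative, also for t < 0, and f = 0 contributes 1. -/
lemma weightEnum_pos {W : Submodule (ZMod 2) (Bits n)} (hW : ∀ f ∈ W, Even (hammingNorm f))
    (t : ℝ) : 1 ≤ weightEnum W t := by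
  have h : t ^ hammingNorm (0 : Bits n) ≤ weightEnum W t :=
    Finset.single_le_sum (f := fun f : Bits n => t ^ hammingNorm f)
      (fun f hf => (hW f (mem_elems.1 hf)).pow_nonneg t) (mem_elems.2 (zero_mem W))
  simpa using h

lemma even_of_mem_evenSpace (hG : IsTriorthogonal G)
    (heven : ∀ b : Fin r, Even (hammingNorm (evenRow G b))) {f : Bits n}
    (hf : f ∈ evenSpace G) : Even (hammingNorm f) := by
  rw [even_iff_natCast, ← dotProduct_self_eq]
  exact evenSpace_le_dual_rowSpace hG heven hf f (evenSpace_le_rowSpace hf)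

end Distill

/-! ### Marginals and error rates -/

lemma marginal_ketbra_ketAs {k : ℕ} (x : Bits k) (a : Fin k) :
    marginal (ketbra (ketAs x)) a = ketbra (ketA (x a)) := by
  classical
  ext s t
  have h : ∀ y : Bits k, ketbra (ketAs x) (Function.update y a s) (Function.update y a t) =
      ketbra (ketA (x a)) s t * ∏ j ∈ Finset.univ.erase a, (1 / 2 : ℂ) := by
    intro y
    simp only [ketbra, vecMulVec_apply, Pi.star_apply, ketAs, tensorVec, RCLike.star_def, map_prod,
      ← Finset.prod_mul_distrib]
    rw [← Finset.mul_prod_erase _ _ (Finset.mem_univ a), Function.update_self,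
      Function.update_self]
    congr 1
    refine Finset.prod_congr rfl fun j hj => ?_
    rw [Function.update_of_ne (Finset.ne_of_mem_erase hj),
      Function.update_of_ne (Finset.ne_of_mem_erase hj), ketA_mul_star]
  have hset : (Finset.univ.filter fun y : Bits k => y a = 0) =
      Fintype.piFinset fun j => if j = a then {0} else Finset.univ := by
    ext y
    simp only [Finset.mem_filter, Finset.mem_univ, true_and, Fintype.mem_piFinset]
    constructor
    · intro hy j
      by_cases hj : j = a
      · subst hj; simp [hy]
      · simp [hj]
    · intro hy
      simpa using hy a
  -- The count is written as a product over the traced-out qubits, to cancel factor by factor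
  -- against the halves |⟨s|A_α⟩|².
  have hcard : ((Finset.univ.filter fun y : Bits k => y a = 0).card : ℂ) =
      ∏ j ∈ Finset.univ.erase a, (2 : ℂ) := by
    rw [hset, Fintype.card_piFinset, ← Finset.mul_prod_erase _ _ (Finset.mem_univ a)]
    push_cast
    rw [if_pos rfl, Finset.card_singleton, Nat.cast_one, one_mul]
    refine Finset.prod_congr rfl fun j hj => ?_
    rw [if_neg (Finset.ne_of_mem_erase hj), Finset.card_univ, ZMod.card]
    norm_num
  rw [marginal, Matrix.of_apply]
  simp only [h]
  rw [Finset.sum_const, nsmul_eq_mul, hcard, mul_left_comm, ← Finset.prod_mul_distrib]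
  simp

lemma marginal_smul {k : ℕ} (c : ℂ) (ρ : Op k) (a : Fin k) :
    marginal (c • ρ) a = c • marginal ρ a := by
  ext s t
  simp [marginal, Finset.mul_sum]

lemma marginal_sum {k : ℕ} {ι : Type*} (S : Finset ι) (ρ : ι → Op k) (a : Fin k) :
    marginal (∑ i ∈ S, ρ i) a = ∑ i ∈ S, marginal (ρ i) a := by
  ext s t
  simp only [marginal, Matrix.of_apply, Matrix.sum_apply]
  exact Finset.sum_comm

lemma star_ketA_dotProduct (α β : ZMod 2) :
    star (ketA α) ⬝ᵥ ketA β = if α = β then 1 else 0 := by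
  have h : ∀ s, star (ketA α) s * ketA β s = 1 / 2 * sgn ((α + β) * s) := by
    intro s
    rw [← ketA_mul_star 0 s]
    simp only [Pi.star_apply, RCLike.star_def, ketA_apply, map_mul, map_pow, star_sgn, add_mul,
      AddChar.map_add_eq_mul, zero_mul, AddChar.map_zero_eq_one, one_mul]
    ring
  rw [dotProduct, show (Finset.univ : Finset (ZMod 2)) = {0, 1} from rfl,
    Finset.sum_pair (by decide), h, h]
  have h2 : (1 + 1 : ZMod 2) = 0 := by decide
  rcases zmod_two_cases α with rfl | rfl <;> rcases zmod_two_cases β with rfl | rfl <;>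
    simp only [h2, add_zero, zero_add, mul_zero, mul_one, AddChar.map_zero_eq_one, sgn_one,
      one_ne_zero, zero_ne_one, if_true, if_false] <;> norm_num

lemma ketbra_overlap (v w : ZMod 2 → ℂ) :
    star w ⬝ᵥ (ketbra v *ᵥ w) = (star w ⬝ᵥ v) * (star v ⬝ᵥ w) := by
  rw [ketbra, vecMulVec_mulVec, dotProduct_smul]
  simp [mul_comm]

/-! ### Error rates and their order as p tends to 0 -/

section Distill

variable {k r n : ℕ} {G : Matrix (Fin (k + r)) (Fin n) (ZMod 2)}

lemma marginal_mixture (p : ℝ) (a : Fin k) :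
    marginal (mixture G p) a =
      ((∑ x : Bits k with x a = 0, pOut G p x : ℝ) : ℂ) • ketbra (ketA 0) +
        ((∑ x : Bits k with ¬ x a = 0, pOut G p x : ℝ) : ℂ) • ketbra (ketA 1) := by
  rw [mixture, marginal_sum,
    ← Finset.sum_filter_add_sum_filter_not Finset.univ (fun x : Bits k => x a = 0)]
  simp only [marginal_smul, marginal_ketbra_ketAs, Complex.ofReal_sum, Finset.sum_smul]
  congr 1
  · refine Finset.sum_congr rfl fun x hx => ?_
    rw [(Finset.mem_filter.1 hx).2]
  · refine Finset.sum_congr rfl fun x hx => ?_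
    rw [(zmod_two_cases _).resolve_left (Finset.mem_filter.1 hx).2]

lemma weightEnum_evenSpace_pos (hG : IsTriorthogonal G)
    (heven : ∀ b : Fin r, Even (hammingNorm (evenRow G b))) (t : ℝ) :
    1 ≤ weightEnum (evenSpace G) t :=
  weightEnum_pos (fun _ => even_of_mem_evenSpace hG heven) t

lemma inv_card_le_sum_errProb (hG : IsTriorthogonal G)
    (heven : ∀ b : Fin r, Even (hammingNorm (evenRow G b))) (p : ℝ) :
    (Nat.card (evenSpace G) : ℝ)⁻¹ ≤ ∑ f ∈ elems (dual (evenSpace G)), errProb p f := by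
  rw [sum_errProb_dual]
  exact le_mul_of_one_le_right (inv_nonneg.2 (Nat.cast_nonneg _))
    (weightEnum_evenSpace_pos hG heven _)

lemma successProb_eq_sum_errProb (hG : IsTriorthogonal G)
    (hodd : ∀ a : Fin k, Odd (hammingNorm (oddRow G a)))
    (heven : ∀ b : Fin r, Even (hammingNorm (evenRow G b))) {U : Op n} (hU : IsCorrecting G U)
    (p : ℝ) :
    successProb G U (rawAncillas n p) = ∑ f ∈ elems (dual (evenSpace G)), errProb p f := by
  rw [successProb_eq hG hodd heven hU, sum_pOut hG hodd heven]

lemma inv_card_pos (W : Submodule (ZMod 2) (Bits n)) : 0 < (Nat.card W : ℝ)⁻¹ :=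
  inv_pos.2 (Nat.cast_pos.2 (card_pos_submodule W))

lemma successProb_pos (hG : IsTriorthogonal G)
    (hodd : ∀ a : Fin k, Odd (hammingNorm (oddRow G a)))
    (heven : ∀ b : Fin r, Even (hammingNorm (evenRow G b))) {U : Op n} (hU : IsCorrecting G U)
    (p : ℝ) : 0 < successProb G U (rawAncillas n p) := by
  rw [successProb_eq_sum_errProb hG hodd heven hU]
  exact (inv_card_pos _).trans_le (inv_card_le_sum_errProb hG heven p)

lemma outputError_eq (hG : IsTriorthogonal G)
    (hodd : ∀ a : Fin k, Odd (hammingNorm (oddRow G a)))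
    (heven : ∀ b : Fin r, Even (hammingNorm (evenRow G b))) {U : Op n} (hU : IsCorrecting G U)
    (p : ℝ) (a : Fin k) :
    outputError G U (rawAncillas n p) a = 1 - (successProb G U (rawAncillas n p))⁻¹ *
      ∑ x : Bits k with x a = 0, pOut G p x := by
  rw [outputError, outputState_eq hG hodd heven hU, marginal_smul, marginal_mixture, smul_mulVec,
    add_mulVec, smul_mulVec, smul_mulVec, dotProduct_smul, dotProduct_add, dotProduct_smul,
    dotProduct_smul, ketbra_overlap, ketbra_overlap]
  simp only [star_ketA_dotProduct, if_true, zero_ne_one, if_false, smul_eq_mul, mul_one, mul_zero,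
    zero_mul, add_zero]
  rw [← Complex.ofReal_inv, ← Complex.ofReal_mul, Complex.ofReal_re]

lemma marginal_outputState (hG : IsTriorthogonal G)
    (hodd : ∀ a : Fin k, Odd (hammingNorm (oddRow G a)))
    (heven : ∀ b : Fin r, Even (hammingNorm (evenRow G b))) {U : Op n} (hU : IsCorrecting G U)
    (p : ℝ) (a : Fin k) :
    marginal (outputState G U (rawAncillas n p)) a =
      ((1 - outputError G U (rawAncillas n p) a : ℝ) : ℂ) • ketbra (ketA 0) +
        ((outputError G U (rawAncillas n p) a : ℝ) : ℂ) • ketbra (ketA 1) := by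
  have hP := (successProb_pos hG hodd heven hU p).ne'
  have h1 : outputError G U (rawAncillas n p) a = (successProb G U (rawAncillas n p))⁻¹ *
      ∑ x : Bits k with ¬ x a = 0, pOut G p x := by
    rw [outputError_eq hG hodd heven hU, ← inv_mul_cancel₀ hP]
    nth_rewrite 2 [successProb_eq hG hodd heven hU]
    rw [← Finset.sum_filter_add_sum_filter_not Finset.univ (fun x : Bits k => x a = 0)]
    ring
  have h0 : 1 - outputError G U (rawAncillas n p) a = (successProb G U (rawAncillas n p))⁻¹ *
      ∑ x : Bits k with x a = 0, pOut G p x := by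
    rw [outputError_eq hG hodd heven hU]; ring
  rw [h0, h1, outputState_eq hG hodd heven hU, marginal_smul, marginal_mixture, smul_add,
    smul_smul, smul_smul]
  push_cast
  rfl

lemma mem_dual_sup_oddRow {f : Bits n} (a : Fin k) :
    f ∈ dual (evenSpace G ⊔ Submodule.span (ZMod 2) {oddRow G a}) ↔
      f ∈ dual (evenSpace G) ∧ coord G f a = 0 := by
  rw [mem_dual_sup, mem_dual_span]
  simp [coord]

lemma elems_dual_sup_oddRow (a : Fin k) :
    elems (dual (evenSpace G ⊔ Submodule.span (ZMod 2) {oddRow G a})) =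
      (elems (dual (evenSpace G))).filter fun f => coord G f a = 0 := by
  ext f
  simp [mem_dual_sup_oddRow]

lemma sum_pOut_coord (hG : IsTriorthogonal G)
    (hodd : ∀ a : Fin k, Odd (hammingNorm (oddRow G a)))
    (heven : ∀ b : Fin r, Even (hammingNorm (evenRow G b))) (p : ℝ) (a : Fin k) :
    ∑ x : Bits k with x a = 0, pOut G p x =
      ∑ f ∈ elems (dual (evenSpace G ⊔ Submodule.span (ZMod 2) {oddRow G a})),
        errProb p f := by
  rw [elems_dual_sup_oddRow, ← Finset.sum_fiberwise_of_maps_to (g := coord G)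
    (t := Finset.univ.filter fun x : Bits k => x a = 0)]
  · refine Finset.sum_congr rfl fun x hx => ?_
    rw [pOut_eq hG hodd heven, Finset.filter_filter]
    refine Finset.sum_congr (Finset.filter_congr fun f _ => ?_) fun _ _ => rfl
    constructor
    · rintro rfl; exact ⟨(Finset.mem_filter.1 hx).2, rfl⟩
    · exact fun h => h.2
  · intro f hf
    simpa using (Finset.mem_filter.1 hf).2

lemma outputError_eq_div (hG : IsTriorthogonal G)
    (hodd : ∀ a : Fin k, Odd (hammingNorm (oddRow G a)))
    (heven : ∀ b : Fin r, Even (hammingNorm (evenRow G b))) {U : Op n} (hU : IsCorrecting G U)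
    (p : ℝ) (a : Fin k) :
    outputError G U (rawAncillas n p) a =
      1 - (∑ f ∈ elems (dual (evenSpace G ⊔ Submodule.span (ZMod 2) {oddRow G a})),
          errProb p f) / (∑ f ∈ elems (dual (evenSpace G)), errProb p f) := by
  rw [outputError_eq hG hodd heven hU, sum_pOut_coord hG hodd heven,
    successProb_eq_sum_errProb hG hodd heven hU, mul_comm, div_eq_mul_inv]

lemma oddRow_notMem_evenSpace (hG : IsTriorthogonal G)
    (heven : ∀ b : Fin r, Even (hammingNorm (evenRow G b))) {a : Fin k}
    (hodd : Odd (hammingNorm (oddRow G a))) : oddRow G a ∉ evenSpace G :=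
  fun h => Nat.not_even_iff_odd.2 hodd (even_of_mem_evenSpace hG heven h)

lemma outputError_eq_weightEnum (hG : IsTriorthogonal G)
    (hodd : ∀ a : Fin k, Odd (hammingNorm (oddRow G a)))
    (heven : ∀ b : Fin r, Even (hammingNorm (evenRow G b))) {U : Op n} (hU : IsCorrecting G U)
    (p : ℝ) (a : Fin k) :
    outputError G U (rawAncillas n p) a = 1 - 1 / 2 *
      (weightEnum (evenSpace G ⊔ Submodule.span (ZMod 2) {oddRow G a}) (1 - 2 * p) /
        weightEnum (evenSpace G) (1 - 2 * p)) := by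
  have hc : (Nat.card (evenSpace G) : ℝ) ≠ 0 := Nat.cast_ne_zero.2 (card_pos_submodule _).ne'
  have hw : weightEnum (evenSpace G) (1 - 2 * p) ≠ 0 :=
    (zero_lt_one.trans_le (weightEnum_evenSpace_pos hG heven _)).ne'
  rw [outputError_eq_div hG hodd heven hU, sum_errProb_dual, sum_errProb_dual,
    card_sup_span_singleton _ (oddRow_notMem_evenSpace hG heven (hodd a))]
  push_cast
  field_simp

lemma zDistance_isLeast (hG : IsTriorthogonal G)
    (hodd : ∀ a : Fin k, Odd (hammingNorm (oddRow G a)))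
    (heven : ∀ b : Fin r, Even (hammingNorm (evenRow G b))) (hk : 0 < k) :
    IsLeast {w | ∃ f ∈ dual (evenSpace G), f ∉ dual (rowSpace G) ∧ hammingNorm f = w}
      (zDistance G) := by
  -- An odd row is orthogonal to 𝒢₀ but not to itself. Nonemptiness matters, since `sInf` of the
  -- empty set is 0.
  refine ⟨Nat.sInf_mem ⟨_, oddRow G ⟨0, hk⟩,
    rowSpace_le_dual_evenSpace hG heven (oddRow_mem_rowSpace _), fun h => ?_, rfl⟩,
    fun w hw => Nat.sInf_le hw⟩
  have h1 := h _ (oddRow_mem_rowSpace ⟨0, hk⟩)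
  rw [oddRow_dotProduct_oddRow hG hodd, if_pos rfl] at h1
  exact one_ne_zero h1

lemma errProb_le_pow {p : ℝ} (h0 : 0 ≤ p) (h1 : p ≤ 1) {f : Bits n} {d : ℕ}
    (hd : d ≤ hammingNorm f) : errProb p f ≤ p ^ d :=
  (mul_le_of_le_one_left (pow_nonneg h0 _)
    (pow_le_one₀ (sub_nonneg.2 h1) (sub_le_self _ h0))).trans (pow_le_pow_of_le_one h0 h1 hd)

/-- The failing errors are the undetected ones that flip qubit a. Unlike 1 minus a ratio, this form
shows both the sign and the order in p. -/
lemma outputError_eq_sum_div (hG : IsTriorthogonal G)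
    (hodd : ∀ a : Fin k, Odd (hammingNorm (oddRow G a)))
    (heven : ∀ b : Fin r, Even (hammingNorm (evenRow G b))) {U : Op n} (hU : IsCorrecting G U)
    (p : ℝ) (a : Fin k) :
    outputError G U (rawAncillas n p) a =
      (∑ f ∈ elems (dual (evenSpace G)) with ¬ coord G f a = 0, errProb p f) /
        (∑ f ∈ elems (dual (evenSpace G)), errProb p f) := by
  have hP : ∑ f ∈ elems (dual (evenSpace G)), errProb p f ≠ 0 :=
    ((inv_card_pos _).trans_le (inv_card_le_sum_errProb hG heven p)).ne'
  rw [outputError_eq_div hG hodd heven hU, elems_dual_sup_oddRow, eq_div_iff hP, sub_mul, one_mul,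
    div_mul_cancel₀ _ hP,
    ← Finset.sum_filter_add_sum_filter_not (elems (dual (evenSpace G))) (fun f => coord G f a = 0)]
  ring

lemma outputError_nonneg (hG : IsTriorthogonal G)
    (hodd : ∀ a : Fin k, Odd (hammingNorm (oddRow G a)))
    (heven : ∀ b : Fin r, Even (hammingNorm (evenRow G b))) {U : Op n} (hU : IsCorrecting G U)
    {p : ℝ} (h0 : 0 ≤ p) (h1 : p ≤ 1) (a : Fin k) :
    0 ≤ outputError G U (rawAncillas n p) a := by
  rw [outputError_eq_sum_div hG hodd heven hU]
  exact div_nonneg (Finset.sum_nonneg fun f _ => errProb_nonneg h0 h1 f)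
    (Finset.sum_nonneg fun f _ => errProb_nonneg h0 h1 f)

/-- Each failing error lies outside 𝒢^⊥, hence has weight at least d and probability at most p^d;
there are at most |𝒢₀^⊥| of them, and P_s ≥ 1/|𝒢₀|. -/
lemma outputError_le (hG : IsTriorthogonal G)
    (hodd : ∀ a : Fin k, Odd (hammingNorm (oddRow G a)))
    (heven : ∀ b : Fin r, Even (hammingNorm (evenRow G b))) {U : Op n} (hU : IsCorrecting G U)
    {p : ℝ} (h0 : 0 ≤ p) (h1 : p ≤ 1) (a : Fin k) :
    outputError G U (rawAncillas n p) a ≤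
      (Nat.card (dual (evenSpace G)) * Nat.card (evenSpace G)) * p ^ zDistance G := by
  have hk : 0 < k := a.pos
  have hP := (inv_card_pos _).trans_le (inv_card_le_sum_errProb hG heven p)
  have hc : (0 : ℝ) < Nat.card (evenSpace G) := Nat.cast_pos.2 (card_pos_submodule _)
  have hnum : ∑ f ∈ elems (dual (evenSpace G)) with ¬ coord G f a = 0, errProb p f ≤
      Nat.card (dual (evenSpace G)) * p ^ zDistance G := by
    refine (Finset.sum_le_card_nsmul _ _ (p ^ zDistance G) fun f hf => ?_).trans ?_
    · rw [Finset.mem_filter, mem_elems] at hf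
      exact errProb_le_pow h0 h1 ((zDistance_isLeast hG hodd heven hk).2
        ⟨f, hf.1, fun h => hf.2 (h _ (oddRow_mem_rowSpace a)), rfl⟩)
    · rw [nsmul_eq_mul, ← card_elems]
      exact mul_le_mul_of_nonneg_right (Nat.cast_le.2 (Finset.card_filter_le _ _))
        (pow_nonneg h0 _)
  rw [outputError_eq_sum_div hG hodd heven hU, div_le_iff₀ hP]
  refine hnum.trans ?_
  have h2 : 1 ≤ (Nat.card (evenSpace G) : ℝ) *
      ∑ f ∈ elems (dual (evenSpace G)), errProb p f := by
    have := mul_le_mul_of_nonneg_left (inv_card_le_sum_errProb hG heven p) hc.le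
    rwa [mul_inv_cancel₀ hc.ne'] at this
  calc _ ≤ (Nat.card (dual (evenSpace G)) * p ^ zDistance G) *
        ((Nat.card (evenSpace G) : ℝ) * ∑ f ∈ elems (dual (evenSpace G)), errProb p f) :=
        le_mul_of_one_le_right (mul_nonneg (Nat.cast_nonneg _) (pow_nonneg h0 _)) h2
    _ = _ := by ring

lemma worstError_isBigO (hG : IsTriorthogonal G)
    (hodd : ∀ a : Fin k, Odd (hammingNorm (oddRow G a)))
    (heven : ∀ b : Fin r, Even (hammingNorm (evenRow G b))) {U : Op n} (hU : IsCorrecting G U) :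
    (fun p : ℝ => worstError G U (rawAncillas n p))
      =O[𝓝[≥] (0 : ℝ)] (fun p : ℝ => p ^ zDistance G) := by
  refine IsBigO.of_bound (Nat.card (dual (evenSpace G)) * Nat.card (evenSpace G)) ?_
  filter_upwards [Icc_mem_nhdsGE (zero_lt_one' ℝ)] with p hp
  have h0 : 0 ≤ worstError G U (rawAncillas n p) :=
    Real.iSup_nonneg fun a => outputError_nonneg hG hodd heven hU hp.1 hp.2 a
  rw [Real.norm_of_nonneg h0, Real.norm_of_nonneg (pow_nonneg hp.1 _)]
  -- Nonnegativity of the bound is required because a real supremum over an empty index type is 0.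
  exact Real.iSup_le (fun a => outputError_le hG hodd heven hU hp.1 hp.2 a)
    (mul_nonneg (by positivity) (pow_nonneg hp.1 _))

end Distill

end MagicDistill

theorem mainTheorem4 {k r n : ℕ} (G : Matrix (Fin (k + r)) (Fin n) (ZMod 2))
    (hG : IsTriorthogonal G)
    (hodd : ∀ a : Fin k, Odd (hammingNorm (oddRow G a)))
    (heven : ∀ b : Fin r, Even (hammingNorm (evenRow G b))) :
    (∃ U : Op n, IsCorrecting G U) ∧
    ((encoder G)ᴴ * encoder G = 1 ∧ encoder G * (encoder G)ᴴ = codeProj G) ∧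
    (∀ p : ℝ, 0 ≤ p → p ≤ 1 → ∀ η : Op n, injectT η (rawAncillas n p) = noisyT p η) ∧
    ∀ U : Op n, IsCorrecting G U →
      (∀ p : ℝ, 0 ≤ p → p ≤ 1 →
        0 < successProb G U (rawAncillas n p) ∧
        successProb G U (rawAncillas n p) =
          ∑ f ∈ elems (dual (evenSpace G)), errProb p f ∧
        successProb G U (rawAncillas n p) =
          (Nat.card (evenSpace G) : ℝ)⁻¹ * weightEnum (evenSpace G) (1 - 2 * p) ∧
        postSelected G U (rawAncillas n p) =
          codeProj G * etaTwo G U (rawAncillas n p) * codeProj G ∧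
        etaThree G U (rawAncillas n p) =
          encoder G * outputState G U (rawAncillas n p) * (encoder G)ᴴ ∧
        outputState G U (rawAncillas n p) =
          ((successProb G U (rawAncillas n p) : ℝ) : ℂ)⁻¹ •
            ∑ x : Bits k, ((pOut G p x : ℝ) : ℂ) • ketbra (ketAs x) ∧
        ∀ a : Fin k,
          marginal (outputState G U (rawAncillas n p)) a =
            ((1 - outputError G U (rawAncillas n p) a : ℝ) : ℂ) • ketbra (ketA 0) +
              ((outputError G U (rawAncillas n p) a : ℝ) : ℂ) • ketbra (ketA 1) ∧
          outputError G U (rawAncillas n p) a =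
            1 - (successProb G U (rawAncillas n p))⁻¹ *
              (∑ x : Bits k with x a = 0, pOut G p x) ∧
          outputError G U (rawAncillas n p) a =
            1 - (∑ f ∈ elems (dual (evenSpace G ⊔ Submodule.span (ZMod 2) {oddRow G a})),
                  errProb p f) /
                (∑ f ∈ elems (dual (evenSpace G)), errProb p f) ∧
          outputError G U (rawAncillas n p) a =
            1 - 1 / 2 *
              (weightEnum (evenSpace G ⊔ Submodule.span (ZMod 2) {oddRow G a}) (1 - 2 * p) /
                weightEnum (evenSpace G) (1 - 2 * p))) ∧
      (0 < k →
        IsLeast {w | ∃ f ∈ dual (evenSpace G), f ∉ dual (rowSpace G) ∧ hammingNorm f = w}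
          (zDistance G) ∧
        (fun p : ℝ => worstError G U (rawAncillas n p))
          =O[𝓝[≥] (0 : ℝ)] (fun p : ℝ => p ^ zDistance G)) := by
  refine ⟨exists_isCorrecting hG hodd heven,
    ⟨encoder_conjTranspose_mul_self hG hodd heven, encoder_mul_conjTranspose hG hodd heven⟩,
    fun p _ _ η => injectT_eq_noisyT p η, fun U hU => ⟨fun p _ _ =>
      ⟨successProb_pos hG hodd heven hU p, successProb_eq_sum_errProb hG hodd heven hU p, ?_,
      postSelected_eq_codeProj hG hodd heven hU p, etaThree_eq hG hodd heven hU p,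
      outputState_eq hG hodd heven hU p, fun a => ⟨marginal_outputState hG hodd heven hU p a,
      outputError_eq hG hodd heven hU p a, outputError_eq_div hG hodd heven hU p a,
      outputError_eq_weightEnum hG hodd heven hU p a⟩⟩,
    fun hk => ⟨zDistance_isLeast hG hodd heven hk, worstError_isBigO hG hodd heven hU⟩⟩⟩
  rw [successProb_eq_sum_errProb hG hodd heven hU, sum_errProb_dual]
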